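/- Let $A$ be a set of actions. **Star expressions and Milner's system.** Star expressions over $A$ are given by $e ::= 0 \mid 1 \mid a \mid e+e \mid e\cdot e \mid e^*$ with $a\in A$. Immediate termination $e{\downarrow}$ is defined by: $1{\downarrow}$; $(e_1+e_2){\downarrow}$ if $e_1{\downarrow}$ or $e_2{\downarrow}$; $(e_1\cdot e_2){\downarrow}$ if $e_1{\downarrow}$ and $e_2{\downarrow}$; $(e^*){\downarrow}$. The system $\mathsf{Mil}^-$ derives equations between star expressions by reflexivity, symmetry, transitivity, filling of contexts, and the axioms $(e+f)+g=e+(f+g)$, $e+0=e$, $e+f=f+e$, $e+e=e$, $(e\cdot f)\cdot g=e\cdot(f\cdot g)$, $(e+f)\cdot g=e\cdot g+f\cdot g$, $1\cdot e=e$, $e\cdot 1=e$, $0\cdot e=0$, $e^*=1+e\cdot e^*$, $e^*=(1+e)^*$. Milner's system $\mathsf{Mil}$ adds the rule $\mathsf{RSP}^*$: from $e=f\cdot e+g$ infer $e=f^*\cdot g$, if not $f{\downarrow}$. **1-charts.** A 1-chart is a finite rooted transition graph with transition labels in $A\cup\{1\}$, $1\notin A$ being the empty step label, and with a set of vertices with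 immediate termination. It is weakly guarded if it has no cycle of $1$-transitions. It is a loop 1-chart if there is an infinite path from the start vertex, every infinite path from the start vertex returns to it after a positive number of steps, and only the start vertex may terminate immediately. A loop sub-1-chart of a 1-chart at a vertex $v$ is a loop 1-chart with start vertex $v$ that is built, for a nonempty set $U$ of transitions from $v$ (its loop-entry transitions), from all paths that start with a transition in $U$ and continue until $v$ is reached again; its other transitions form its body. It is eliminated by removing its loop-entry transitions and then everything that is unreachable from the start vertex. A LLEE-1-chart is one from which repeated elimination of loop sub-1-charts can lead to a 1-chart without infinite path, in such a way that loop-entry transitions are never removed from the body of a previously eliminated loop sub-1-chart. **The 1-chart interpretation** of $e$ is the 1-chart that consists of everything reachable from $e$ in the following transition system on star expressions with an additional stacked product $E\star e^*$, where $e,e_1,e_2$ are star expressions, $E,E'$ stacked ones, $a\in A$, and $\alpha\in A\cup\{1\}$: $a\xrightarrow{a}1$; $e_1+e_2\xrightarrow{a}E'$ if $e_i\xrightarrow{a}E'$ for some $i\in\{1,2\}$; $e^*\xrightarrow{a}E'\star e^*$ if $e\xrightarrow{a}E'$; $E\cdot e\xrightarrow{\alpha}E'\cdot e$ and $E\star e^*\xrightarrow{\alpha}E'\star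 e^*$ if $E\xrightarrow{\alpha}E'$; $e_1\cdot e_2\xrightarrow{a}E'$ if $e_1{\downarrow}$ and $e_2\xrightarrow{a}E'$; $e_1\star e_2^*\xrightarrow{1}e_2^*$ if $e_1{\downarrow}$. Vertices that contain $\star$ do not terminate immediately; the others do so as star expressions. **Coinductive proofs and $\mathsf{cMil}_1$.** For a set $\Gamma$ of equations, a LLEE-witnessed coinductive proof over $\mathsf{Mil}^-{+}\Gamma$ of $e=f$ is a weakly guarded LLEE-1-chart whose vertices $v$ are labeled by equations $L_1(v)=L_2(v)$, with the equation $e=f$ at the start vertex, such that for each $j\in\{1,2\}$ and each vertex $v$ with transitions $v\xrightarrow{\alpha_i}v_i$ ($1\le i\le n$) the equation $L_j(v)=\tau(v)+\sum_{i=1}^n\alpha_i\cdot L_j(v_i)$ is provable in $\mathsf{Mil}^-{+}\Gamma$; here $\tau(v)$ is $1$ if $v$ terminates immediately, and $0$ otherwise. The system $\mathsf{cMil}_1$ adds to $\mathsf{Mil}^-$ the rule $\mathsf{LCoindProof}_1$: from an equation $g=h$ and a LLEE-witnessed coinductive proof over $\mathsf{Mil}^-{+}\{g=h\}$ of $e=f$,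 infer $e=f$. **Theorem.** Every equation that is derivable in $\mathsf{Mil}$ is derivable in $\mathsf{cMil}_1$. What is more, there is an effective transformation of derivations in $\mathsf{Mil}$ into derivations in $\mathsf{cMil}_1$ with the same conclusion, which replaces every instance of $\mathsf{RSP}^*$, with premise $e=f\cdot e+g$ (where not $f{\downarrow}$) and conclusion $e=f^*\cdot g$, by an instance of $\mathsf{LCoindProof}_1$ with the same equation premise and the same conclusion, whose other premise is a LLEE-witnessed coinductive proof over $\mathsf{Mil}^-{+}\{e=f\cdot e+g\}$ of $e=f^*\cdot g$ with the 1-chart interpretation of $f^*\cdot g$ as its underlying 1-chart, and which leaves all other rule and axiom instances unchanged. Here effective means that the transformation is given by a computable function on natural-number codes of derivations, relative to any naming by natural numbers that distinguishes the actions occurring in the derivation. -/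

import Mathlib

open Relation

universe u v

/-! ## Star expressions -/

/-- Star expressions over a set `A` of actions. -/
inductive StExp (A : Type u) : Type u where
  | zero : StExp A
  | one : StExp A
  | act (a : A) : StExp A
  | add (e f : StExp A) : StExp A
  | mul (e f : StExp A) : StExp A
  | star (e : StExp A) : StExp A

/-- Immediate termination of star expressions. -/
inductive StExp.Term {A : Type u} : StExp A → Prop where
  | one : StExp.Term StExp.one
  | addL {e f : StExp A} : StExp.Term e → StExp.Term (StExp.add e f)
  | addR {e f : StExp A} : StExp.Term f → StExp.Term (StExp.add e f)
  | mul {e f : StExp A} : StExp.Term e → StExp.Term f → StExp.Term (StExp.mul e f)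
  | star {e : StExp A} : StExp.Term (StExp.star e)

/-- The sum `e₁ + … + eₙ`, associated to the left; it is `0` for `n = 0` and `e₁` for `n = 1`. -/
def StExp.sum {A : Type u} : List (StExp A) → StExp A
  | [] => StExp.zero
  | e :: l => l.foldl StExp.add e

/-- The set of actions that occur in a star expression. -/
def StExp.acts {A : Type u} : StExp A → Set A
  | .zero => ∅
  | .one => ∅
  | .act a => {a}
  | .add e f => e.acts ∪ f.acts
  | .mul e f => e.acts ∪ f.acts
  | .star e => e.acts

/-- Star expression contexts with precisely one hole. -/
inductive StCxt (A : Type u) : Type u where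
  | hole : StCxt A
  | addL (C : StCxt A) (e : StExp A) : StCxt A
  | addR (e : StExp A) (C : StCxt A) : StCxt A
  | mulL (C : StCxt A) (e : StExp A) : StCxt A
  | mulR (e : StExp A) (C : StCxt A) : StCxt A
  | star (C : StCxt A) : StCxt A

/-- The result `C[e]` of filling the hole of `C` with `e`. -/
def StCxt.fill {A : Type u} : StCxt A → StExp A → StExp A
  | .hole, e => e
  | .addL C f, e => StExp.add (C.fill e) f
  | .addR f C, e => StExp.add f (C.fill e)
  | .mulL C f, e => StExp.mul (C.fill e) f
  | .mulR f C, e => StExp.mul f (C.fill e)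
  | .star C, e => StExp.star (C.fill e)

/-! ## Milner's system `Mil` and its equational part `Mil⁻` -/

/-- `MilAxiom e f`: the formal equation `e = f` is an axiom of `Mil⁻`. -/
inductive MilAxiom {A : Type u} : StExp A → StExp A → Prop where
  | addAssoc (e f g : StExp A) :
      MilAxiom (StExp.add (StExp.add e f) g) (StExp.add e (StExp.add f g))
  | addZero (e : StExp A) : MilAxiom (StExp.add e StExp.zero) e
  | addComm (e f : StExp A) : MilAxiom (StExp.add e f) (StExp.add f e)
  | addIdem (e : StExp A) : MilAxiom (StExp.add e e) e
  | mulAssoc (e f g : StExp A) :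
      MilAxiom (StExp.mul (StExp.mul e f) g) (StExp.mul e (StExp.mul f g))
  | rightDistr (e f g : StExp A) :
      MilAxiom (StExp.mul (StExp.add e f) g) (StExp.add (StExp.mul e g) (StExp.mul f g))
  | oneMul (e : StExp A) : MilAxiom (StExp.mul StExp.one e) e
  | mulOne (e : StExp A) : MilAxiom (StExp.mul e StExp.one) e
  | deadlock (e : StExp A) : MilAxiom (StExp.mul StExp.zero e) StExp.zero
  | recStar (e : StExp A) :
      MilAxiom (StExp.star e) (StExp.add StExp.one (StExp.mul e (StExp.star e)))
  | trmBody (e : StExp A) : MilAxiom (StExp.star e) (StExp.star (StExp.add StExp.one e))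

/-- Provability in `Mil⁻ + Γ`, the system that arises from `Mil⁻` by adding the formal equations in
`Γ` as axioms. -/
inductive MilMinusProv {A : Type u} (Γ : Set (StExp A × StExp A)) : StExp A → StExp A → Prop where
  | ax {e f : StExp A} : MilAxiom e f → MilMinusProv Γ e f
  | hyp {e f : StExp A} : (e, f) ∈ Γ → MilMinusProv Γ e f
  | refl (e : StExp A) : MilMinusProv Γ e e
  | symm {e f : StExp A} : MilMinusProv Γ e f → MilMinusProv Γ f e
  | trans {e f g : StExp A} : MilMinusProv Γ e f → MilMinusProv Γ f g → MilMinusProv Γ e g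
  | cxt (C : StCxt A) {e f : StExp A} :
      MilMinusProv Γ e f → MilMinusProv Γ (C.fill e) (C.fill f)

/-- `MilDeriv e f`: the derivation trees in Milner's system `Mil` (without assumptions) that have
conclusion `e = f`. The last constructor is the rule RSP*. -/
inductive MilDeriv {A : Type u} : StExp A → StExp A → Type u where
  | ax {e f : StExp A} (h : MilAxiom e f) : MilDeriv e f
  | refl (e : StExp A) : MilDeriv e e
  | symm {e f : StExp A} (D : MilDeriv e f) : MilDeriv f e
  | trans {e f g : StExp A} (D₁ : MilDeriv e f) (D₂ : MilDeriv f g) : MilDeriv e g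
  | cxt (C : StCxt A) {e f : StExp A} (D : MilDeriv e f) : MilDeriv (C.fill e) (C.fill f)
  | rsp {e f g : StExp A} (hf : ¬ f.Term) (D : MilDeriv e (StExp.add (StExp.mul f e) g)) :
      MilDeriv e (StExp.mul (StExp.star f) g)

/-! ## 1-charts -/

/-- Finite 1-charts with vertices taken from `V` and proper actions from `A`. The label `none` is
the empty step label `1`. The three finite sets of the chart are given by lists, whose order and
repetitions carry no meaning. -/
structure OneChart (A : Type u) (V : Type v) where
  verts : List V
  start : V
  trans : List (V × Option A × V)
  term : List V
  start_mem : start ∈ verts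
  trans_mem : ∀ τ ∈ trans, τ.1 ∈ verts ∧ τ.2.2 ∈ verts
  term_mem : ∀ w ∈ term, w ∈ verts

/-- There are no cycles of `1`-transitions. -/
def OneChart.WeaklyGuarded {A : Type u} {V : Type v} (C : OneChart A V) : Prop :=
  ∀ x : V, ¬ TransGen (fun y z => (y, none, z) ∈ C.trans) x x

/-- An action label as a star expression, where the empty step label is read as `1`. -/
def labelExp {A : Type u} : Option A → StExp A
  | none => StExp.one
  | some a => StExp.act a

open Classical in
/-- The termination constant of `C` at `x`. -/
noncomputable def OneChart.termConst {A : Type u} {V : Type v} (C : OneChart A V) (x : V) :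
    StExp A :=
  if x ∈ C.term then StExp.one else StExp.zero

/-- `s` is an `S`-provable solution of `C` at `x`, where `S` is the relation of provable equality.
The condition is demanded for every list representation `l` of the transitions from `x`. -/
def OneChart.IsSolutionAt {A : Type u} {V : Type v} (C : OneChart A V)
    (S : StExp A → StExp A → Prop) (s : V → StExp A) (x : V) : Prop :=
  ∀ l : List (Option A × V), (∀ α y, (α, y) ∈ l ↔ (x, α, y) ∈ C.trans) →
    S (s x) (StExp.add (C.termConst x)
      (StExp.sum (l.map fun p => StExp.mul (labelExp p.1) (s p.2))))

/-- `s` is an `S`-provable solution of `C`. Only the values of `s` on the vertices matter. -/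
def OneChart.IsSolution {A : Type u} {V : Type v} (C : OneChart A V)
    (S : StExp A → StExp A → Prop) (s : V → StExp A) : Prop :=
  ∀ x ∈ C.verts, C.IsSolutionAt S s x

/-! ## Layered loop existence and elimination

In the following, `T` is the set of transitions of a 1-chart. -/

/-- There is a transition in `T` from `x` to `y`. -/
def StepIn {A : Type u} {V : Type v} (T : Set (V × Option A × V)) (x y : V) : Prop :=
  ∃ α, (x, α, y) ∈ T

/-- `p` is an infinite path of transitions in `T`. -/
def InfPath {A : Type u} {V : Type v} (T : Set (V × Option A × V)) (p : ℕ → V) : Prop :=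
  ∀ i, StepIn T (p i) (p (i + 1))

/-- The conditions (L1), (L2), (L3) for a loop 1-chart with start vertex `x`, set `T` of
transitions, and set `M` of vertices with immediate termination. -/
def IsLoopChart {A : Type u} {V : Type v} (T : Set (V × Option A × V)) (M : Set V) (x : V) :
    Prop :=
  (∃ p, InfPath T p ∧ p 0 = x) ∧
  (∀ p, InfPath T p → p 0 = x → ∃ i, 0 < i ∧ p i = x) ∧
  (∀ y ∈ M, y = x)

/-- `y` is reached by a path that starts with a transition in `U` (a set of transitions from `x`)
and continues with transitions in `T`, but only until `x` is reached again. -/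
def ReachedUntil {A : Type u} {V : Type v} (T : Set (V × Option A × V)) (x : V)
    (U : Set (V × Option A × V)) (y : V) : Prop :=
  ∃ α w, (x, α, w) ∈ U ∧ ReflTransGen (fun p q => p ≠ x ∧ StepIn T p q) w y

/-- The loop-body transitions of the sub-1-chart that is constructed, for a set `U` of transitions
from `x`, by all paths that start with a transition in `U` and continue until `x` is reached again.
The set of all transitions of this sub-1-chart is `U ∪ bodyTrans T x U`. -/
def bodyTrans {A : Type u} {V : Type v} (T : Set (V × Option A × V)) (x : V)
    (U : Set (V × Option A × V)) : Set (V × Option A × V) :=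
  {τ | τ ∈ T ∧ τ.1 ≠ x ∧ ReachedUntil T x U τ.1}

/-- `U` is the set of loop-entry transitions of a loop sub-1-chart at `x` of the 1-chart with
transitions `T` and set `M` of vertices with immediate termination. -/
def IsLoopSub {A : Type u} {V : Type v} (T : Set (V × Option A × V)) (M : Set V) (x : V)
    (U : Set (V × Option A × V)) : Prop :=
  U.Nonempty ∧ (∀ τ ∈ U, τ ∈ T ∧ τ.1 = x) ∧
  IsLoopChart (U ∪ bodyTrans T x U) {y | y ∈ M ∧ (y = x ∨ ReachedUntil T x U y)} x

/-- The transitions that remain when those in `U` are removed, and then everything that is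
unreachable from the start vertex `r`. -/
def elimTrans {A : Type u} {V : Type v} (r : V) (T U : Set (V × Option A × V)) :
    Set (V × Option A × V) :=
  {τ | τ ∈ T \ U ∧ ReflTransGen (StepIn (T \ U)) r τ.1}

/-- `LayeredElim r M T B`: from the 1-chart with start vertex `r`, transitions `T` and set `M` of
vertices with immediate termination, repeated elimination of loop sub-1-charts can lead to a
1-chart without an infinite path, where loop-entry transitions are never removed from the body of a
previously eliminated loop sub-1-chart. Here `B` collects the body transitions of the loop
sub-1-charts that have been eliminated before. -/
inductive LayeredElim {A : Type u} {V : Type v} (r : V) (M : Set V) :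
    Set (V × Option A × V) → Set (V × Option A × V) → Prop where
  | done {T B : Set (V × Option A × V)} (h : ¬ ∃ p, InfPath T p) : LayeredElim r M T B
  | step {T B : Set (V × Option A × V)} (x : V) (U : Set (V × Option A × V))
      (hU : IsLoopSub T M x U) (hB : Disjoint U B)
      (h : LayeredElim r M (elimTrans r T U) (B ∪ bodyTrans T x U)) : LayeredElim r M T B

/-- `C` is a LLEE-1-chart: it satisfies the layered loop existence and elimination property. -/
def OneChart.LLEE {A : Type u} {V : Type v} (C : OneChart A V) : Prop :=
  LayeredElim C.start {y | y ∈ C.term} {τ | τ ∈ C.trans} ∅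

/-! ## The 1-chart interpretation of star expressions -/

/-- Stacked star expressions `E ::= 0 | 1 | a | e + e | E · e | e* | E ⋆ e*`, for star expressions
`e`; here `stk E e` stands for the stacked product `E ⋆ e*`. -/
inductive StackExp (A : Type u) : Type u where
  | zero : StackExp A
  | one : StackExp A
  | act (a : A) : StackExp A
  | add (e f : StExp A) : StackExp A
  | mul (E : StackExp A) (e : StExp A) : StackExp A
  | star (e : StExp A) : StackExp A
  | stk (E : StackExp A) (e : StExp A) : StackExp A

/-- Star expressions as stacked star expressions (without stacked product). -/
def StExp.toStack {A : Type u} : StExp A → StackExp A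
  | .zero => .zero
  | .one => .one
  | .act a => .act a
  | .add e f => .add e f
  | .mul e f => .mul e.toStack f
  | .star e => .star e

/-- Immediate termination of stacked star expressions: as for star expressions, and there is none
for expressions with stacked product. -/
inductive StackExp.Term {A : Type u} : StackExp A → Prop where
  | ofExp {e : StExp A} : e.Term → StackExp.Term e.toStack

/-- The transitions between stacked star expressions; the label `none` is the empty step `1`. -/
inductive StackStep {A : Type u} : StackExp A → Option A → StackExp A → Prop where
  | act (a : A) : StackStep (.act a) (some a) .one
  | addL {e f : StExp A} {a : A} {E : StackExp A} :
      StackStep e.toStack (some a) E → StackStep (.add e f) (some a) E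
  | addR {e f : StExp A} {a : A} {E : StackExp A} :
      StackStep f.toStack (some a) E → StackStep (.add e f) (some a) E
  | star {e : StExp A} {a : A} {E : StackExp A} :
      StackStep e.toStack (some a) E → StackStep (.star e) (some a) (.stk E e)
  | mulL {E E' : StackExp A} {α : Option A} {e : StExp A} :
      StackStep E α E' → StackStep (.mul E e) α (.mul E' e)
  | stkL {E E' : StackExp A} {α : Option A} {e : StExp A} :
      StackStep E α E' → StackStep (.stk E e) α (.stk E' e)
  | mulR {E E' : StackExp A} {a : A} {e : StExp A} :
      E.Term → StackStep e.toStack (some a) E' → StackStep (.mul E e) (some a) E'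
  | stkOne {E : StackExp A} {e : StExp A} : E.Term → StackStep (.stk E e) none (.star e)

/-- `E'` is reachable from `E`. -/
def StackReach {A : Type u} (E E' : StackExp A) : Prop :=
  ReflTransGen (fun F F' => ∃ α, StackStep F α F') E E'

/-- `C` is the 1-chart interpretation of `e`: the sub-1-chart, of the transition system on stacked
star expressions, that is rooted at `e` and consists of everything reachable from `e`. -/
def OneChart.IsInterpretation {A : Type u} (C : OneChart A (StackExp A)) (e : StExp A) : Prop :=
  C.start = e.toStack ∧
  (∀ E, E ∈ C.verts ↔ StackReach e.toStack E) ∧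
  (∀ E α E', (E, α, E') ∈ C.trans ↔ StackReach e.toStack E ∧ StackStep E α E') ∧
  (∀ E, E ∈ C.term ↔ StackReach e.toStack E ∧ E.Term)

/-! ## LLEE-witnessed coinductive proofs, and the system `cMil₁` -/

/-- LLEE-witnessed coinductive proofs over `Mil⁻ + Γ` of `e = f`, on 1-charts with vertices in `V`.
The vertex `x` is labeled by the equation `lhs x = rhs x`; the values of `lhs` and `rhs` outside of
the vertex set are irrelevant. -/
structure LLEECoindProof {A : Type u} (V : Type v) (Γ : Set (StExp A × StExp A))
    (e f : StExp A) where
  chart : OneChart A V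
  lhs : V → StExp A
  rhs : V → StExp A
  weaklyGuarded : chart.WeaklyGuarded
  llee : chart.LLEE
  lhs_solution : chart.IsSolution (MilMinusProv Γ) lhs
  rhs_solution : chart.IsSolution (MilMinusProv Γ) rhs
  lhs_start : lhs chart.start = e
  rhs_start : rhs chart.start = f

/-- `CMilOneDeriv V e f`: the derivation trees in the system `cMil₁` (without assumptions) that have
conclusion `e = f`, where the vertices of 1-charts are taken from `V`. The last constructor is the
rule LCoindProof₁. -/
inductive CMilOneDeriv {A : Type u} (V : Type v) : StExp A → StExp A → Type (max u v) where
  | ax {e f : StExp A} (h : MilAxiom e f) : CMilOneDeriv V e f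
  | refl (e : StExp A) : CMilOneDeriv V e e
  | symm {e f : StExp A} (D : CMilOneDeriv V e f) : CMilOneDeriv V f e
  | trans {e f g : StExp A} (D₁ : CMilOneDeriv V e f) (D₂ : CMilOneDeriv V f g) :
      CMilOneDeriv V e g
  | cxt (C : StCxt A) {e f : StExp A} (D : CMilOneDeriv V e f) :
      CMilOneDeriv V (C.fill e) (C.fill f)
  | lcoind {g h e f : StExp A} (D : CMilOneDeriv V g h) (P : LLEECoindProof V {(g, h)} e f) :
      CMilOneDeriv V e f

/-- `Mimics D D'`: the derivation `D'` in `cMil₁` arises from the derivation `D` in `Mil` by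
replacing every instance of RSP*, with premise `e = f · e + g` and conclusion `e = f* · g`, by an
instance of LCoindProof₁ with the same equation premise and conclusion, whose other premise is a
LLEE-witnessed coinductive proof with the 1-chart interpretation of `f* · g` as underlying
1-chart. -/
inductive Mimics {A : Type u} : {e f : StExp A} → MilDeriv e f →
    CMilOneDeriv (StackExp A) e f → Prop where
  | ax {e f : StExp A} (h : MilAxiom e f) : Mimics (.ax h) (.ax h)
  | refl (e : StExp A) : Mimics (.refl e) (.refl e)
  | symm {e f : StExp A} {D : MilDeriv e f} {D' : CMilOneDeriv (StackExp A) e f} :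
      Mimics D D' → Mimics (.symm D) (.symm D')
  | trans {e f g : StExp A} {D₁ : MilDeriv e f} {D₂ : MilDeriv f g}
      {D₁' : CMilOneDeriv (StackExp A) e f} {D₂' : CMilOneDeriv (StackExp A) f g} :
      Mimics D₁ D₁' → Mimics D₂ D₂' → Mimics (.trans D₁ D₂) (.trans D₁' D₂')
  | cxt (C : StCxt A) {e f : StExp A} {D : MilDeriv e f}
      {D' : CMilOneDeriv (StackExp A) e f} :
      Mimics D D' → Mimics (.cxt C D) (.cxt C D')
  | rsp {e f g : StExp A} (hf : ¬ f.Term)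
      {D : MilDeriv e (StExp.add (StExp.mul f e) g)}
      {D' : CMilOneDeriv (StackExp A) e (StExp.add (StExp.mul f e) g)}
      (P : LLEECoindProof (StackExp A) {(e, StExp.add (StExp.mul f e) g)} e
        (StExp.mul (StExp.star f) g)) :
      Mimics D D' → P.chart.IsInterpretation (StExp.mul (StExp.star f) g) →
      Mimics (.rsp hf D) (.lcoind D' P)

/-! ## Effectiveness

Expressions, charts and derivations are coded by natural numbers, relative to a naming
`c : A → ℕ` of the actions by numbers. -/

/-- The code of a star expression. -/
def StExp.code {A : Type u} (c : A → ℕ) : StExp A → ℕ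
  | .zero => Nat.pair 1 0
  | .one => Nat.pair 2 0
  | .act a => Nat.pair 3 (c a)
  | .add e f => Nat.pair 4 (Nat.pair (e.code c) (f.code c))
  | .mul e f => Nat.pair 5 (Nat.pair (e.code c) (f.code c))
  | .star e => Nat.pair 6 (e.code c)

/-- The code of a stacked star expression. -/
def StackExp.code {A : Type u} (c : A → ℕ) : StackExp A → ℕ
  | .zero => Nat.pair 1 0
  | .one => Nat.pair 2 0
  | .act a => Nat.pair 3 (c a)
  | .add e f => Nat.pair 4 (Nat.pair (e.code c) (f.code c))
  | .mul E f => Nat.pair 5 (Nat.pair (E.code c) (f.code c))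
  | .star e => Nat.pair 6 (e.code c)
  | .stk E e => Nat.pair 7 (Nat.pair (E.code c) (e.code c))

/-- The code of a context. -/
def StCxt.code {A : Type u} (c : A → ℕ) : StCxt A → ℕ
  | .hole => Nat.pair 1 0
  | .addL C e => Nat.pair 2 (Nat.pair (C.code c) (e.code c))
  | .addR e C => Nat.pair 3 (Nat.pair (e.code c) (C.code c))
  | .mulL C e => Nat.pair 4 (Nat.pair (C.code c) (e.code c))
  | .mulR e C => Nat.pair 5 (Nat.pair (e.code c) (C.code c))
  | .star C => Nat.pair 6 (C.code c)

/-- The code of a formal equation `e = f`. -/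
def eqnCode {A : Type u} (c : A → ℕ) (e f : StExp A) : ℕ :=
  Nat.pair (e.code c) (f.code c)

/-- The code of a derivation in `Mil`: every node of the tree records its rule and its formula, and
instances of the context rule record the context. -/
def MilDeriv.code {A : Type u} (c : A → ℕ) : {e f : StExp A} → MilDeriv e f → ℕ
  | e, f, .ax _ => Nat.pair 1 (Nat.pair (eqnCode c e f) 0)
  | _, _, .refl e => Nat.pair 2 (Nat.pair (eqnCode c e e) 0)
  | e, f, .symm D => Nat.pair 3 (Nat.pair (eqnCode c e f) (D.code c))
  | e, f, .trans D₁ D₂ =>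
      Nat.pair 4 (Nat.pair (eqnCode c e f) (Nat.pair (D₁.code c) (D₂.code c)))
  | _, _, .cxt (e := e) (f := f) C D =>
      Nat.pair 5 (Nat.pair (eqnCode c (C.fill e) (C.fill f)) (Nat.pair (C.code c) (D.code c)))
  | _, _, .rsp (e := e) (f := f) (g := g) _ D =>
      Nat.pair 6 (Nat.pair (eqnCode c e (StExp.mul (StExp.star f) g)) (D.code c))

/-- The set of actions that occur in (the formulas of) a derivation in `Mil`. -/
def MilDeriv.acts {A : Type u} : {e f : StExp A} → MilDeriv e f → Set A
  | e, f, .ax _ => e.acts ∪ f.acts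
  | _, _, .refl e => e.acts
  | e, f, .symm D => e.acts ∪ f.acts ∪ D.acts
  | e, f, .trans D₁ D₂ => e.acts ∪ f.acts ∪ D₁.acts ∪ D₂.acts
  | _, _, .cxt (e := e) (f := f) C D => (C.fill e).acts ∪ (C.fill f).acts ∪ D.acts
  | _, _, .rsp (e := e) (f := f) (g := g) _ D =>
      e.acts ∪ (StExp.mul (StExp.star f) g).acts ∪ D.acts

/-- The code of a 1-chart, relative to namings `c` of actions and `d` of vertices. -/
def OneChart.code {A : Type u} {V : Type v} (c : A → ℕ) (d : V → ℕ) (C : OneChart A V) : ℕ :=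
  Encodable.encode
    (C.verts.map d, d C.start,
      C.trans.map (fun τ => (d τ.1, τ.2.1.map c, d τ.2.2)), C.term.map d)

/-- The code of a LLEE-witnessed coinductive proof: its 1-chart, and the list of its vertices
together with the two sides of the equations that label them. -/
def LLEECoindProof.code {A : Type u} {V : Type v} (c : A → ℕ) (d : V → ℕ)
    {Γ : Set (StExp A × StExp A)} {e f : StExp A} (P : LLEECoindProof V Γ e f) : ℕ :=
  Nat.pair (P.chart.code c d)
    (Encodable.encode (P.chart.verts.map fun x => (d x, (P.lhs x).code c, (P.rhs x).code c)))

/-- The code of a derivation in `cMil₁`. -/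
def CMilOneDeriv.code {A : Type u} {V : Type v} (c : A → ℕ) (d : V → ℕ) :
    {e f : StExp A} → CMilOneDeriv V e f → ℕ
  | e, f, .ax _ => Nat.pair 1 (Nat.pair (eqnCode c e f) 0)
  | _, _, .refl e => Nat.pair 2 (Nat.pair (eqnCode c e e) 0)
  | e, f, .symm D => Nat.pair 3 (Nat.pair (eqnCode c e f) (D.code c d))
  | e, f, .trans D₁ D₂ =>
      Nat.pair 4 (Nat.pair (eqnCode c e f) (Nat.pair (D₁.code c d) (D₂.code c d)))
  | _, _, .cxt (e := e) (f := f) C D =>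
      Nat.pair 5 (Nat.pair (eqnCode c (C.fill e) (C.fill f)) (Nat.pair (C.code c) (D.code c d)))
  | e, f, .lcoind D P =>
      Nat.pair 6 (Nat.pair (eqnCode c e f) (Nat.pair (D.code c d) (P.code c d)))

/-- A transformation `T` of derivations in `Mil` into derivations in `cMil₁` is effective if it is
given by a computable function on codes. The set `A` is arbitrary, but each derivation contains
only finitely many actions: the computable function has to be correct for every naming `c` of
actions by numbers that distinguishes the actions in the given derivation. -/
def Effective {A : Type u}
    (T : (e f : StExp A) → MilDeriv e f → CMilOneDeriv (StackExp A) e f) : Prop :=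
  ∃ F : ℕ → ℕ, Computable F ∧
    ∀ (e f : StExp A) (D : MilDeriv e f) (c : A → ℕ), Set.InjOn c D.acts →
      F (D.code c) = (T e f D).code c (StackExp.code c)

/-!
An instance of `RSP*`, with premise `e = f · e + g` and conclusion `e = f* · g`, is replaced by a
coinductive proof on the 1-chart interpretation of `f* · g`. Its vertices are `f* · g`, the
`(F ⋆ f*) · g` for derivatives `F` of `f`, and derivatives of `g`. Reading `⋆` as the product yields
a solution of every 1-chart interpretation, since each star expression is provably the sum of its
termination constant and its derivatives (`StackExp.mk_eq_transSum`); this gives the right-hand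
sides. For the left-hand sides (`rspLhs`), the factor `f* · g` is replaced by `e`: this is a solution
as well, where the premise is used at the start vertex only, and there `f` is the sum of its
derivatives because it does not terminate immediately (`isSolution_rspLhs`).

Weak guardedness and layered loop elimination of 1-chart interpretations both rest on the fact that
the transitions other than the loop-entry transitions `e* → E ⋆ e*`, in contexts, form a terminating
relation (`wellFounded_stackExit`). Empty steps are among them, so they form no cycles. Moreover,
on an infinite path a loop-entry transition recurs, and since `E ⋆ e*` does not terminate, its loop
can be left only through its start vertex (`StackInner.step`). The star height of the leftmost
factor decreases from the start vertex of a loop to its interior, so the loops can be eliminated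
starting from those of minimal star height (`layeredElim_of_entries`).

The 1-chart is enumerated by structural recursion, without comparing actions (`StExp.derivs`,
`StackExp.succ`), and so is the labeling. Therefore the transformation commutes with every naming of
the actions by numbers, and on codes it is a course-of-values recursion, hence primitive recursive
(`primrec_toCMilCode`, `MilDeriv.toCMilCode_code`).
-/

/-! ### Layered elimination of loops -/

section Elimination

variable {A : Type u} {V : Type v}

theorem StepIn.mono {T T' : Set (V × Option A × V)} (h : T ⊆ T') {x y : V} (hxy : StepIn T x y) :
    StepIn T' x y :=
  hxy.imp fun _ ha => h ha

theorem InfPath.mono {T T' : Set (V × Option A × V)} (h : T ⊆ T') {p : ℕ → V}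
    (hp : InfPath T p) : InfPath T' p :=
  fun i => (hp i).mono h

theorem exists_infPath_of_transGen {T : Set (V × Option A × V)} {x : V}
    (h : TransGen (StepIn T) x x) : ∃ p, InfPath T p ∧ p 0 = x := by
  have next : ∀ y : {y // TransGen (StepIn T) y x}, ∃ z : {z // TransGen (StepIn T) z x},
      StepIn T y.1 z.1 := by
    rintro ⟨y, hy⟩
    obtain ⟨z, hyz, hzx⟩ := TransGen.head'_iff.1 hy
    exact ⟨⟨z, TransGen.trans_right hzx h⟩, hyz⟩
  choose nx hnx using next
  refine ⟨fun n => (nx^[n] ⟨x, h⟩).1, fun i => ?_, rfl⟩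
  change StepIn T (nx^[i] _).1 (nx^[i + 1] _).1
  rw [Function.iterate_succ_apply']
  exact hnx _

/-- In `T`, the vertex `x` lies on a cycle that leaves `x` by a transition in `W`. -/
def OnLoop (T W : Set (V × Option A × V)) (x : V) : Prop :=
  ∃ α w, (x, α, w) ∈ T ∩ W ∧ ReflTransGen (StepIn T) w x

theorem OnLoop.mono {T T' W : Set (V × Option A × V)} (h : T ⊆ T') {x : V}
    (hx : OnLoop T W x) : OnLoop T' W x := by
  obtain ⟨α, w, hw, hr⟩ := hx
  exact ⟨α, w, ⟨h hw.1, hw.2⟩, ReflTransGen.mono (fun _ _ => StepIn.mono h) _ _ hr⟩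

theorem InfPath.reflTransGen {T : Set (V × Option A × V)} {p : ℕ → V} (hp : InfPath T p)
    {i j : ℕ} (hij : i ≤ j) : ReflTransGen (StepIn T) (p i) (p j) := by
  induction j, hij using Nat.le_induction with
  | base => exact .refl
  | succ j _ ih => exact ih.tail (hp j)

/-- If every infinite path uses transitions in `W` infinitely often, then, by the pigeonhole
principle, it leaves some vertex twice by such a transition. -/
theorem InfPath.exists_onLoop {T W : Set (V × Option A × V)} (hfin : T.Finite)
    (hW : ¬ ∃ p, InfPath (T \ W) p) {p : ℕ → V} (hp : InfPath T p) :
    ∃ i, OnLoop T W (p i) := by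
  have hI : {i | ∃ α, (p i, α, p (i + 1)) ∈ T ∩ W}.Infinite := by
    intro hf
    obtain ⟨N, hN⟩ := hf.bddAbove
    refine hW ⟨fun i => p (N + 1 + i), fun i => ?_⟩
    obtain ⟨α, hα⟩ := hp (N + 1 + i)
    refine ⟨α, hα, fun hαW => ?_⟩
    have := hN (show N + 1 + i ∈ _ from ⟨α, hα, hαW⟩)
    omega
  obtain ⟨i, hi, j, hj, hne, heq⟩ := hI.exists_ne_map_eq_of_mapsTo (f := p)
    (t := Prod.fst '' T) (fun i ⟨α, hα⟩ => ⟨_, hα.1, rfl⟩) (hfin.image _)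
  have key : ∀ i j : ℕ, i < j → p i = p j → (∃ α, (p i, α, p (i + 1)) ∈ T ∩ W) →
      OnLoop T W (p i) := by
    rintro i j hij heq ⟨α, hα⟩
    exact ⟨α, _, hα, heq ▸ hp.reflTransGen (Nat.succ_le_of_lt hij)⟩
  rcases lt_or_gt_of_ne hne with h | h
  · exact ⟨i, key i j h heq hi⟩
  · exact ⟨j, key j i h heq.symm hj⟩

theorem reflTransGen_until {R : V → V → Prop} {x w : V} (h : ReflTransGen R w x) :
    ReflTransGen (fun p q => p ≠ x ∧ R p q) w x := by
  induction h using ReflTransGen.head_induction_on with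
  | refl => exact .refl
  | @head a b hab _ ih =>
    by_cases ha : a = x
    · subst ha; exact .refl
    · exact .head ⟨ha, hab⟩ ih

theorem elimTrans_subset (r : V) (T U : Set (V × Option A × V)) : elimTrans r T U ⊆ T \ U :=
  fun _ h => h.1

/-- From a vertex on a loop there is an infinite path through its loop sub-1-chart. -/
theorem OnLoop.exists_infPath {T W : Set (V × Option A × V)} {x : V} (hx : OnLoop T W x) :
    ∃ p, InfPath ({τ ∈ T ∩ W | τ.1 = x} ∪ bodyTrans T x {τ ∈ T ∩ W | τ.1 = x}) p ∧ p 0 = x := by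
  obtain ⟨α, w, hw, hr⟩ := hx
  refine exists_infPath_of_transGen (TransGen.head' ⟨α, .inl ⟨hw, rfl⟩⟩ ?_)
  suffices ∀ y, ReflTransGen (fun p q => p ≠ x ∧ StepIn T p q) w y →
      ReflTransGen (StepIn ({τ ∈ T ∩ W | τ.1 = x} ∪
        bodyTrans T x {τ ∈ T ∩ W | τ.1 = x})) w y from
    this x (reflTransGen_until hr)
  intro y hy
  induction hy with
  | refl => exact .refl
  | tail hwb hbc ih =>
    obtain ⟨hne, β, hβ⟩ := hbc
    exact ih.tail ⟨β, .inr ⟨hβ, hne, α, w, ⟨hw, rfl⟩, hwb⟩⟩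

/-- A criterion for layered loop existence and elimination. The transitions in `W` are the
loop-entry transitions, `inner x y` expresses that `y` is in the interior of the loop at `x`, and
`rank` decreases from a loop to its interior.

As long as there is an infinite path, there is a vertex on a loop, and a vertex of minimal rank
among those can be eliminated: an infinite path in the interior of its loop would pass through
a loop vertex of smaller rank. The interiors of eliminated loops contain no loop vertices any
more, whence later loop-entry transitions are not in the body of earlier loops. -/
theorem layeredElim_of_entries {r : V} {M : Set V} {T₀ W : Set (V × Option A × V)}
    {inner : V → V → Prop} {rank : V → ℕ} (hfin : T₀.Finite)
    (hW : ¬ ∃ p, InfPath (T₀ \ W) p)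
    (hentry : ∀ x α y, (x, α, y) ∈ T₀ ∩ W → inner x y)
    (hstep : ∀ x y z, inner x y → StepIn T₀ y z → inner x z ∨ z = x)
    (hterm : ∀ x y, inner x y → y ∉ M)
    (hrank : ∀ x y, inner x y → rank y < rank x) :
    LayeredElim r M T₀ ∅ := by
  suffices ∀ (n : ℕ) (T B : Set (V × Option A × V)), T.ncard = n → T ⊆ T₀ →
      -- Loop-entry transitions in the body of an eliminated loop start no cycle any more.
      (∀ τ ∈ B, τ ∈ W → ¬ OnLoop T W τ.1) → LayeredElim r M T B from
    this _ T₀ ∅ rfl subset_rfl (by simp)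
  intro n
  induction n using Nat.strong_induction_on with
  | _ n IH =>
  intro T B hn hT hB
  have hTfin : T.Finite := hfin.subset hT
  have hTW : ¬ ∃ p, InfPath (T \ W) p := fun ⟨p, hp⟩ =>
    hW ⟨p, hp.mono (Set.sdiff_subset_sdiff_left hT)⟩
  by_cases hinf : ∃ p, InfPath T p
  swap
  · exact .done hinf
  obtain ⟨p, hp⟩ := hinf
  have hex : ∃ k x, OnLoop T W x ∧ rank x = k := by
    obtain ⟨i, hi⟩ := hp.exists_onLoop hTfin hTW
    exact ⟨_, _, hi, rfl⟩
  classical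
  obtain ⟨x, hx, hxk⟩ := Nat.find_spec hex
  have hmin : ∀ y, OnLoop T W y → rank x ≤ rank y := fun y hy =>
    hxk ▸ Nat.find_min' hex ⟨y, hy, rfl⟩
  set U : Set (V × Option A × V) := {τ ∈ T ∩ W | τ.1 = x} with hU
  have hreach : ∀ y, ReachedUntil T x U y → inner x y ∨ y = x := by
    rintro y ⟨α, w, hw, hr⟩
    induction hr with
    | refl => exact .inl (hentry _ _ _ ⟨hT hw.1.1, hw.1.2⟩)
    | tail _ hbc ih =>
      rcases ih with ih | ih
      · exact hstep _ _ _ ih (hbc.2.mono hT)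
      · exact absurd ih hbc.1
  have hbody : ∀ τ ∈ bodyTrans T x U, inner x τ.1 := fun τ hτ =>
    (hreach _ hτ.2.2).resolve_right hτ.2.1
  refine .step x U ⟨?_, fun τ hτ => ⟨hτ.1.1, hτ.2⟩, hx.exists_infPath, ?_, ?_⟩ ?_ ?_
  · obtain ⟨α, w, hw, -⟩ := hx
    exact ⟨_, hw, rfl⟩
  -- A non-returning infinite path would, from its second vertex on, stay in the interior.
  · intro q hq hq0
    by_contra hcon
    have hq' : ∀ i, q (i + 1) ≠ x := fun i h => hcon ⟨i + 1, i.succ_pos, h⟩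
    have hin : ∀ i, ∃ α, (q (i + 1), α, q (i + 2)) ∈ bodyTrans T x U := by
      intro i
      obtain ⟨α, hα | hα⟩ := hq (i + 1)
      · exact absurd hα.2 (hq' i)
      · exact ⟨α, hα⟩
    have hpath : InfPath T fun i => q (i + 1) := fun i => (hin i).imp fun _ h => h.1
    obtain ⟨i, hi⟩ := hpath.exists_onLoop hTfin hTW
    obtain ⟨α, hα⟩ := hin i
    exact absurd (hmin _ hi) (hrank _ _ (hbody _ hα)).not_ge
  · rintro y ⟨hyM, rfl | hy⟩
    · rfl
    · exact (hreach y hy).resolve_left fun h => hterm _ _ h hyM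
  · rw [Set.disjoint_left]
    intro τ hτ hτB
    exact hB τ hτB hτ.1.2 (hτ.2 ▸ hx)
  · have hsub : elimTrans r T U ⊆ T := fun τ hτ => (elimTrans_subset r T U hτ).1
    refine IH _ ?_ _ _ rfl (hsub.trans hT) ?_
    · rw [← hn]
      refine Set.ncard_lt_ncard ⟨hsub, fun h => ?_⟩ hTfin
      obtain ⟨α, w, hw, -⟩ := hx
      exact (elimTrans_subset r T U (h hw.1)).2 ⟨hw, rfl⟩
    · rintro τ (hτ | hτ) hτW hloop
      · exact hB τ hτ hτW (hloop.mono hsub)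
      · exact absurd (hmin _ (hloop.mono hsub)) (hrank _ _ (hbody τ hτ)).not_ge

end Elimination

/-! ### Loops in the transition system on stacked star expressions -/

section Loops

variable {A : Type u}

/-- The loop-entry transitions: the steps from `e*` to `E ⋆ e*`, in contexts formed from products
and stacked products. -/
inductive StackEntry : StackExp A → Option A → StackExp A → Prop where
  | star {e : StExp A} {a : A} {E : StackExp A} :
      StackStep e.toStack (some a) E → StackEntry (.star e) (some a) (.stk E e)
  | mul {E E' : StackExp A} {α : Option A} {e : StExp A} :
      StackEntry E α E' → StackEntry (.mul E e) α (.mul E' e)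
  | stk {E E' : StackExp A} {α : Option A} {e : StExp A} :
      StackEntry E α E' → StackEntry (.stk E e) α (.stk E' e)

/-- `StackExit E E'`: there is a transition from `E` to `E'` that is not a loop-entry
transition. -/
def StackExit (E E' : StackExp A) : Prop :=
  ∃ α, StackStep E α E' ∧ ¬ StackEntry E α E'

theorem StackEntry.label_ne_none {E E' : StackExp A} : ¬ StackEntry E none E' := by
  generalize hα : (none : Option A) = α
  intro h
  induction h with
  | star _ => cases hα
  | mul _ ih => exact ih hα
  | stk _ ih => exact ih hα

theorem acc_stackExit_mul {E : StackExp A} {f : StExp A}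
    (hE : Acc (Function.swap StackExit) E)
    (hf : ∀ α E', StackStep f.toStack α E' → Acc (Function.swap StackExit) E') :
    Acc (Function.swap StackExit) (.mul E f) := by
  induction hE with
  | intro E _ ih =>
    refine .intro _ ?_
    rintro _ ⟨α, hs, hn⟩
    cases hs with
    | mulL hs => exact ih _ ⟨α, hs, fun h => hn (.mul h)⟩
    | mulR _ hs => exact hf _ _ hs

theorem acc_stackExit_star (e : StExp A) : Acc (Function.swap StackExit) (.star e) := by
  refine .intro _ ?_
  rintro _ ⟨α, hs, hn⟩
  cases hs with
  | star hs => exact absurd (.star hs) hn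

theorem acc_stackExit_stk {E : StackExp A} (e : StExp A)
    (hE : Acc (Function.swap StackExit) E) : Acc (Function.swap StackExit) (.stk E e) := by
  induction hE with
  | intro E _ ih =>
    refine .intro _ ?_
    rintro _ ⟨α, hs, hn⟩
    cases hs with
    | stkL hs => exact ih _ ⟨α, hs, fun h => hn (.stk h)⟩
    | stkOne _ => exact acc_stackExit_star e

/-- After an arbitrary first step from a star expression, only finitely many steps that are not
loop-entry transitions can follow one another. -/
theorem acc_stackExit_of_step (e : StExp A) {α : Option A} {E : StackExp A}
    (h : StackStep e.toStack α E) : Acc (Function.swap StackExit) E := by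
  induction e generalizing α E with
  | zero => cases h
  | one => cases h
  | act a =>
    cases h
    refine .intro _ ?_
    rintro _ ⟨α, hs, -⟩
    cases hs
  | add e f ihe ihf =>
    cases h with
    | addL h => exact ihe h
    | addR h => exact ihf h
  | mul e f ihe ihf =>
    cases h with
    | mulL h => exact acc_stackExit_mul (ihe h) fun _ _ => ihf
    | mulR _ h => exact ihf h
  | star e ih =>
    cases h with
    | star h => exact acc_stackExit_stk e (ih h)

/-- The transitions that are not loop-entry transitions form a terminating relation. -/
theorem wellFounded_stackExit : WellFounded (Function.swap (StackExit (A := A))) := by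
  have hexp (e : StExp A) : Acc (Function.swap StackExit) e.toStack := by
    refine .intro _ ?_
    rintro _ ⟨α, hs, -⟩
    exact acc_stackExit_of_step e hs
  refine ⟨fun E => ?_⟩
  induction E with
  | zero => exact hexp .zero
  | one => exact hexp .one
  | act a => exact hexp (.act a)
  | add e f => exact hexp (.add e f)
  | mul E e ih => exact acc_stackExit_mul ih fun _ _ => acc_stackExit_of_step e
  | star e => exact acc_stackExit_star e
  | stk E e ih => exact acc_stackExit_stk e ih

/-- The star height of a star expression. -/
def StExp.height : StExp A → ℕ
  | .zero => 0
  | .one => 0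
  | .act _ => 0
  | .add e f => max e.height f.height
  | .mul e f => max e.height f.height
  | .star e => e.height + 1

/-- The star height of a stacked star expression; `E ⋆ e*` counts like `E · e*`. -/
def StackExp.height : StackExp A → ℕ
  | .zero => 0
  | .one => 0
  | .act _ => 0
  | .add e f => max e.height f.height
  | .mul E e => max E.height e.height
  | .star e => e.height + 1
  | .stk E e => max E.height (e.height + 1)

/-- The star height of the leftmost factor of a product of stacked star expressions, but `0` if
this factor is not an iteration. -/
def StackExp.headHeight : StackExp A → ℕ
  | .zero => 0
  | .one => 0
  | .act _ => 0
  | .add _ _ => 0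
  | .mul E _ => E.headHeight
  | .star e => e.height + 1
  | .stk E _ => E.headHeight

theorem StExp.height_toStack (e : StExp A) : e.toStack.height = e.height := by
  induction e <;> simp_all [StExp.toStack, StExp.height, StackExp.height]

theorem StackExp.headHeight_le (E : StackExp A) : E.headHeight ≤ E.height := by
  induction E <;> simp_all [StackExp.headHeight, StackExp.height]

theorem StackStep.height_le {E E' : StackExp A} {α : Option A} (h : StackStep E α E') :
    E'.height ≤ E.height := by
  induction h <;> simp_all [StackExp.height, StExp.height_toStack] <;> omega

/-- `StackInner E E'`: the leftmost factor of `E` is an iteration `e*`, and `E'` arises from `E` by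
replacing this factor by `F ⋆ e*`, for some `F` of star height at most that of `e`. -/
inductive StackInner : StackExp A → StackExp A → Prop where
  | star {F : StackExp A} {e : StExp A} :
      F.height ≤ e.height → StackInner (.star e) (.stk F e)
  | mul {E E' : StackExp A} {e : StExp A} :
      StackInner E E' → StackInner (.mul E e) (.mul E' e)
  | stk {E E' : StackExp A} {e : StExp A} :
      StackInner E E' → StackInner (.stk E e) (.stk E' e)

theorem StackEntry.inner {E E' : StackExp A} {α : Option A} (h : StackEntry E α E') :
    StackInner E E' := by
  induction h with
  | star hs => exact .star (hs.height_le.trans_eq (StExp.height_toStack _))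
  | mul _ ih => exact .mul ih
  | stk _ ih => exact .stk ih

theorem StackExp.term_mul {E : StackExp A} {f : StExp A} :
    (StackExp.mul E f).Term ↔ E.Term ∧ f.Term := by
  constructor
  · intro h
    generalize hX : StackExp.mul E f = X at h
    obtain ⟨he⟩ := h
    cases he <;> cases hX
    rename_i h₁ h₂
    exact ⟨.ofExp h₁, h₂⟩
  · rintro ⟨⟨he⟩, hf⟩
    exact .ofExp (.mul he hf)

theorem StackExp.not_term_stk {E : StackExp A} {e : StExp A} : ¬ (StackExp.stk E e).Term := by
  intro h
  generalize hX : StackExp.stk E e = X at h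
  obtain ⟨he⟩ := h
  cases he <;> cases hX

theorem StackInner.not_term {E E' : StackExp A} (h : StackInner E E') : ¬ E'.Term := by
  induction h with
  | star _ => exact StackExp.not_term_stk
  | mul _ ih => exact fun h => ih (StackExp.term_mul.1 h).1
  | stk _ _ => exact StackExp.not_term_stk

theorem StackInner.headHeight_lt {E E' : StackExp A} (h : StackInner E E') :
    E'.headHeight < E.headHeight := by
  induction h with
  | @star F _ h => exact Nat.lt_succ_of_le (F.headHeight_le.trans h)
  | mul _ ih => exact ih
  | stk _ ih => exact ih

/-- The interior of a loop can be left only through the start vertex of the loop. -/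
theorem StackInner.step {E E' F : StackExp A} {α : Option A} (h : StackInner E E')
    (hs : StackStep E' α F) : StackInner E F ∨ F = E := by
  induction h generalizing α F with
  | star h =>
    cases hs with
    | stkL hs => exact .inl (.star (hs.height_le.trans h))
    | stkOne _ => exact .inr rfl
  | mul h ih =>
    cases hs with
    | mulL hs => exact (ih hs).imp .mul (congrArg (StackExp.mul · _))
    | mulR ht _ => exact absurd ht h.not_term
  | stk h ih =>
    cases hs with
    | stkL hs => exact (ih hs).imp .stk (congrArg (StackExp.stk · _))
    | stkOne ht => exact absurd ht h.not_term

/-- A 1-chart in the transition system on stacked star expressions is a LLEE-1-chart. -/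
theorem OneChart.llee_of_stackStep {C : OneChart A (StackExp A)}
    (hs : ∀ E α E', (E, α, E') ∈ C.trans → StackStep E α E') (ht : ∀ E ∈ C.term, E.Term) :
    C.LLEE := by
  refine layeredElim_of_entries (W := {τ | StackEntry τ.1 τ.2.1 τ.2.2}) (inner := StackInner)
    (rank := StackExp.headHeight) C.trans.finite_toSet ?_ (fun _ _ _ h => h.2.inner) ?_
    (fun _ _ h hM => h.not_term (ht _ hM)) fun _ _ h => h.headHeight_lt
  · rintro ⟨p, hp⟩
    refine (wellFounded_iff_isEmpty_descending_chain.1 wellFounded_stackExit).false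
      ⟨p, fun i => ?_⟩
    obtain ⟨α, hα, hn⟩ := hp i
    exact ⟨α, hs _ _ _ hα, hn⟩
  · rintro _ _ _ h ⟨α, hα⟩
    exact h.step (hs _ _ _ hα)

/-- Empty steps are not loop-entry transitions, and hence do not form cycles. -/
theorem OneChart.weaklyGuarded_of_stackStep {C : OneChart A (StackExp A)}
    (hs : ∀ E α E', (E, α, E') ∈ C.trans → StackStep E α E') : C.WeaklyGuarded := by
  intro E h
  have h' : TransGen (Function.swap StackExit) E E :=
    transGen_swap.2 (TransGen.mono
      (fun F F' hF => ⟨none, hs _ _ _ hF, StackEntry.label_ne_none⟩) _ _ h)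
  exact wellFounded_stackExit.transGen.irrefl.irrefl E h'

end Loops

/-! ### Provable equality in `Mil⁻ + Γ` -/

section Provability

variable {A : Type u} (Γ : Set (StExp A × StExp A))

/-- Provable equality in `Mil⁻ + Γ` as an equivalence relation. -/
def milSetoid : Setoid (StExp A) :=
  ⟨MilMinusProv Γ, ⟨.refl, .symm, .trans⟩⟩

/-- The algebra of star expressions modulo provable equality in `Mil⁻ + Γ`. -/
def MilQuot : Type u :=
  Quotient (milSetoid Γ)

namespace MilQuot

variable {Γ}

/-- The class of a star expression modulo provable equality. -/
def mk (e : StExp A) : MilQuot Γ :=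
  Quotient.mk (milSetoid Γ) e

theorem mk_eq {e f : StExp A} : (mk e : MilQuot Γ) = mk f ↔ MilMinusProv Γ e f :=
  Quotient.eq (r := milSetoid Γ)

theorem mk_surj (x : MilQuot Γ) : ∃ e, mk e = x :=
  Quotient.exists_rep x

instance : Add (MilQuot Γ) :=
  ⟨Quotient.map₂ StExp.add fun _ e' h f _ h' =>
    .trans (.cxt (.addL .hole f) h) (.cxt (.addR e' .hole) h')⟩

instance : Mul (MilQuot Γ) :=
  ⟨Quotient.map₂ StExp.mul fun _ e' h f _ h' =>
    .trans (.cxt (.mulL .hole f) h) (.cxt (.mulR e' .hole) h')⟩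

instance : Zero (MilQuot Γ) := ⟨mk .zero⟩

instance : One (MilQuot Γ) := ⟨mk .one⟩

/-- Iteration modulo provable equality. -/
def star : MilQuot Γ → MilQuot Γ :=
  Quotient.map StExp.star fun _ _ h => .cxt (.star .hole) h

@[simp] theorem mk_zero : (mk .zero : MilQuot Γ) = 0 := rfl
@[simp] theorem mk_one : (mk .one : MilQuot Γ) = 1 := rfl
@[simp] theorem mk_add (e f : StExp A) : (mk (.add e f) : MilQuot Γ) = mk e + mk f := rfl
@[simp] theorem mk_mul (e f : StExp A) : (mk (.mul e f) : MilQuot Γ) = mk e * mk f := rfl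
@[simp] theorem mk_star (e : StExp A) : (mk (.star e) : MilQuot Γ) = (mk e).star := rfl

theorem mk_eq_of_axiom {e f : StExp A} (h : MilAxiom e f) : (mk e : MilQuot Γ) = mk f :=
  mk_eq.2 (.ax h)

instance : AddCommMonoid (MilQuot Γ) where
  add_assoc := by
    rintro ⟨e⟩ ⟨f⟩ ⟨g⟩
    exact mk_eq_of_axiom (.addAssoc e f g)
  zero_add := by
    rintro ⟨e⟩
    exact (mk_eq_of_axiom (.addComm .zero e)).trans (mk_eq_of_axiom (.addZero e))
  add_zero := by
    rintro ⟨e⟩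
    exact mk_eq_of_axiom (.addZero e)
  add_comm := by
    rintro ⟨e⟩ ⟨f⟩
    exact mk_eq_of_axiom (.addComm e f)
  nsmul := nsmulRec

instance : Monoid (MilQuot Γ) where
  mul_assoc := by
    rintro ⟨e⟩ ⟨f⟩ ⟨g⟩
    exact mk_eq_of_axiom (.mulAssoc e f g)
  one_mul := by
    rintro ⟨e⟩
    exact mk_eq_of_axiom (.oneMul e)
  mul_one := by
    rintro ⟨e⟩
    exact mk_eq_of_axiom (.mulOne e)

instance : RightDistribClass (MilQuot Γ) where
  right_distrib := by
    rintro ⟨e⟩ ⟨f⟩ ⟨g⟩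
    exact mk_eq_of_axiom (.rightDistr e f g)

protected theorem add_self (x : MilQuot Γ) : x + x = x := by
  obtain ⟨e, rfl⟩ := mk_surj x
  exact mk_eq_of_axiom (.addIdem e)

protected theorem zero_mul (x : MilQuot Γ) : 0 * x = 0 := by
  obtain ⟨e, rfl⟩ := mk_surj x
  exact mk_eq_of_axiom (.deadlock e)

theorem star_eq (x : MilQuot Γ) : x.star = 1 + x * x.star := by
  obtain ⟨e, rfl⟩ := mk_surj x
  exact mk_eq_of_axiom (.recStar e)

theorem star_one_add (x : MilQuot Γ) : (1 + x).star = x.star := by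
  obtain ⟨e, rfl⟩ := mk_surj x
  exact (mk_eq_of_axiom (.trmBody e)).symm

theorem sum_mul (l : List (MilQuot Γ)) (x : MilQuot Γ) :
    l.sum * x = (l.map (· * x)).sum := by
  induction l with
  | nil => exact MilQuot.zero_mul x
  | cons y l ih => rw [List.sum_cons, add_mul, ih, List.map_cons, List.sum_cons]

theorem add_sum_of_mem {l : List (MilQuot Γ)} {x : MilQuot Γ} (h : x ∈ l) :
    x + l.sum = l.sum := by
  induction l with
  | nil => simp at h
  | cons y l ih =>
    rw [List.sum_cons]
    rcases List.mem_cons.1 h with rfl | h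
    · rw [← add_assoc, MilQuot.add_self]
    · rw [add_left_comm, ih h]

theorem sum_add_sum_of_subset {l l' : List (MilQuot Γ)} (h : l ⊆ l') :
    l.sum + l'.sum = l'.sum := by
  induction l with
  | nil => simp
  | cons y l ih =>
    rw [List.sum_cons, add_assoc, ih fun _ hx => h (List.mem_cons_of_mem _ hx),
      add_sum_of_mem (h List.mem_cons_self)]

/-- By associativity, commutativity and idempotence, a sum depends only on the set of its
summands. -/
theorem sum_congr {l l' : List (MilQuot Γ)} (h : ∀ x, x ∈ l ↔ x ∈ l') : l.sum = l'.sum := by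
  rw [← sum_add_sum_of_subset fun x => (h x).2, add_comm,
    sum_add_sum_of_subset fun x => (h x).1]

theorem mk_sum (l : List (StExp A)) : (mk (StExp.sum l) : MilQuot Γ) = (l.map mk).sum := by
  have key (l : List (StExp A)) (e : StExp A) :
      (mk (l.foldl StExp.add e) : MilQuot Γ) = mk e + (l.map mk).sum := by
    induction l generalizing e with
    | nil => simp
    | cons f l ih => simp [ih, add_assoc]
  cases l with
  | nil => rfl
  | cons e l => exact key l e

end MilQuot

end Provability

/-! ### Enumeration of the transitions -/

section Enumeration

variable {A : Type u}

/-- Immediate termination of star expressions, as a Boolean function. -/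
def StExp.termb : StExp A → Bool
  | .zero => false
  | .one => true
  | .act _ => false
  | .add e f => e.termb || f.termb
  | .mul e f => e.termb && f.termb
  | .star _ => true

/-- Immediate termination of stacked star expressions, as a Boolean function. -/
def StackExp.termb : StackExp A → Bool
  | .zero => false
  | .one => true
  | .act _ => false
  | .add e f => e.termb || f.termb
  | .mul E f => E.termb && f.termb
  | .star _ => true
  | .stk _ _ => false

theorem StExp.termb_iff (e : StExp A) : e.termb = true ↔ e.Term := by
  constructor
  · intro h
    induction e with
    | zero => cases h
    | one => exact .one
    | act a => cases h
    | add e f ihe ihf => exact (Bool.or_eq_true_iff.1 h).elim (.addL ∘ ihe) (.addR ∘ ihf)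
    | mul e f ihe ihf =>
      have h := Bool.and_eq_true_iff.1 h
      exact .mul (ihe h.1) (ihf h.2)
    | star e => exact .star
  · intro h
    induction h <;> simp_all [StExp.termb]

theorem StExp.termb_toStack (e : StExp A) : e.toStack.termb = e.termb := by
  induction e <;> simp_all [StExp.toStack, StExp.termb, StackExp.termb]

theorem StackExp.termb_iff (E : StackExp A) : E.termb = true ↔ E.Term := by
  have hexp (e : StExp A) : e.toStack.termb = true → e.toStack.Term := fun h =>
    .ofExp ((StExp.termb_iff e).1 (StExp.termb_toStack e ▸ h))
  constructor
  · intro h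
    induction E with
    | zero => cases h
    | one => exact .ofExp .one
    | act a => cases h
    | add e f => exact hexp (.add e f) h
    | mul E f ih =>
      have h := Bool.and_eq_true_iff.1 h
      exact StackExp.term_mul.2 ⟨ih h.1, (StExp.termb_iff f).1 h.2⟩
    | star e => exact .ofExp .star
    | stk E e => cases h
  · rintro ⟨he⟩
    rw [StExp.termb_toStack]
    exact (StExp.termb_iff _).2 he

/-- The transitions from a star expression. -/
def StExp.succ : StExp A → List (Option A × StackExp A)
  | .zero => []
  | .one => []
  | .act a => [(some a, .one)]
  | .add e f => e.succ ++ f.succ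
  | .mul e f => e.succ.map (fun p => (p.1, .mul p.2 f)) ++ if e.termb then f.succ else []
  | .star e => e.succ.map fun p => (p.1, .stk p.2 e)

/-- The transitions from a stacked star expression. -/
def StackExp.succ : StackExp A → List (Option A × StackExp A)
  | .zero => []
  | .one => []
  | .act a => [(some a, .one)]
  | .add e f => e.succ ++ f.succ
  | .mul E f => E.succ.map (fun p => (p.1, .mul p.2 f)) ++ if E.termb then f.succ else []
  | .star e => e.succ.map fun p => (p.1, .stk p.2 e)
  | .stk E e => E.succ.map (fun p => (p.1, .stk p.2 e)) ++
      if E.termb then [(none, .star e)] else []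

/-- Star expressions have only proper transitions. -/
theorem StExp.exists_label_of_step {e : StExp A} {α : Option A} {E : StackExp A}
    (h : StackStep e.toStack α E) : ∃ a, α = some a := by
  induction e generalizing α E with
  | zero => cases h
  | one => cases h
  | act a => cases h; exact ⟨_, rfl⟩
  | add e f => cases h <;> exact ⟨_, rfl⟩
  | mul e f ih =>
    cases h with
    | mulL h => exact ih h
    | mulR _ _ => exact ⟨_, rfl⟩
  | star e => cases h; exact ⟨_, rfl⟩

theorem StExp.mem_succ {e : StExp A} {α : Option A} {E : StackExp A} :
    (α, E) ∈ e.succ ↔ StackStep e.toStack α E := by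
  induction e generalizing α E with
  | zero => exact ⟨nofun, nofun⟩
  | one => exact ⟨nofun, nofun⟩
  | act a =>
    simp only [StExp.succ, List.mem_singleton, Prod.mk.injEq]
    constructor
    · rintro ⟨rfl, rfl⟩; exact .act a
    · rintro ⟨⟩; exact ⟨rfl, rfl⟩
  | add e f ihe ihf =>
    simp only [StExp.succ, List.mem_append, ihe, ihf]
    constructor
    · rintro (h | h) <;> obtain ⟨a, rfl⟩ := StExp.exists_label_of_step h
      exacts [.addL h, .addR h]
    · rintro (_ | _)
      exacts [.inl ‹_›, .inr ‹_›]
  | mul e f ihe ihf =>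
    simp only [StExp.succ, List.mem_append, List.mem_map, Prod.exists, ihe, Prod.mk.injEq]
    constructor
    · rintro (⟨β, E, h, rfl, rfl⟩ | h)
      · exact .mulL h
      · split_ifs at h with ht
        · have h := ihf.1 h
          obtain ⟨a, rfl⟩ := StExp.exists_label_of_step h
          exact .mulR (.ofExp ((StExp.termb_iff e).1 ht)) h
        · cases h
    · intro h
      cases h with
      | mulL h => exact .inl ⟨_, _, h, rfl, rfl⟩
      | mulR ht h =>
        rw [← StackExp.termb_iff, StExp.termb_toStack] at ht
        rw [if_pos ht]
        exact .inr (ihf.2 h)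
  | star e ih =>
    simp only [StExp.succ, List.mem_map, Prod.exists, ih, Prod.mk.injEq]
    constructor
    · rintro ⟨β, E, h, rfl, rfl⟩
      obtain ⟨a, rfl⟩ := StExp.exists_label_of_step h
      exact .star h
    · intro h
      cases h with
      | star h => exact ⟨_, _, h, rfl, rfl⟩

theorem StackExp.mem_succ {E : StackExp A} {α : Option A} {E' : StackExp A} :
    (α, E') ∈ E.succ ↔ StackStep E α E' := by
  induction E generalizing α E' with
  | zero => exact StExp.mem_succ (e := .zero)
  | one => exact StExp.mem_succ (e := .one)
  | act a => exact StExp.mem_succ (e := .act a)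
  | add e f => exact StExp.mem_succ (e := .add e f)
  | star e => exact StExp.mem_succ (e := .star e)
  | mul E f ih =>
    simp only [StackExp.succ, List.mem_append, List.mem_map, Prod.exists, ih, Prod.mk.injEq]
    constructor
    · rintro (⟨β, E, h, rfl, rfl⟩ | h)
      · exact .mulL h
      · split_ifs at h with ht
        · have h := StExp.mem_succ.1 h
          obtain ⟨a, rfl⟩ := StExp.exists_label_of_step h
          exact .mulR ((StackExp.termb_iff E).1 ht) h
        · cases h
    · intro h
      cases h with
      | mulL h => exact .inl ⟨_, _, h, rfl, rfl⟩
      | mulR ht h =>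
        rw [if_pos ((StackExp.termb_iff E).2 ht)]
        exact .inr (StExp.mem_succ.2 h)
  | stk E e ih =>
    simp only [StackExp.succ, List.mem_append, List.mem_map, Prod.exists, ih, Prod.mk.injEq]
    constructor
    · rintro (⟨β, E, h, rfl, rfl⟩ | h)
      · exact .stkL h
      · split_ifs at h with ht
        · obtain ⟨rfl, rfl⟩ := Prod.mk.injEq .. ▸ List.mem_singleton.1 h
          exact .stkOne ((StackExp.termb_iff E).1 ht)
        · cases h
    · intro h
      cases h with
      | stkL h => exact .inl ⟨_, _, h, rfl, rfl⟩
      | stkOne ht =>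
        rw [if_pos ((StackExp.termb_iff E).2 ht)]
        exact .inr (List.mem_singleton.2 rfl)

end Enumeration

/-! ### Solving the transition system -/

section Solution

variable {A : Type u}

/-- The star expression that arises from a stacked one by reading `⋆` as the product. -/
def StackExp.proj : StackExp A → StExp A
  | .zero => .zero
  | .one => .one
  | .act a => .act a
  | .add e f => .add e f
  | .mul E f => .mul E.proj f
  | .star e => .star e
  | .stk E e => .mul E.proj (.star e)

theorem StExp.proj_toStack (e : StExp A) : e.toStack.proj = e := by
  induction e <;> simp_all [StExp.toStack, StackExp.proj]

variable {Γ : Set (StExp A × StExp A)}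

namespace MilQuot

/-- The termination constant, `1` or `0`, in the algebra of star expressions modulo provable
equality. -/
def ofTerm (b : Bool) : MilQuot Γ :=
  if b then 1 else 0

/-- The sum of the terms `α · s(E)`, for the transitions `(α, E)` in a list. -/
def transSum (s : StackExp A → StExp A) (l : List (Option A × StackExp A)) : MilQuot Γ :=
  (l.map fun p => mk (labelExp p.1) * mk (s p.2)).sum

theorem transSum_append (s : StackExp A → StExp A) (l l' : List (Option A × StackExp A)) :
    (transSum s (l ++ l') : MilQuot Γ) = transSum s l + transSum s l' := by
  simp [transSum]

theorem transSum_congr {s s' : StackExp A → StExp A} {l : List (Option A × StackExp A)}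
    (h : ∀ p ∈ l, s p.2 = s' p.2) : (transSum s l : MilQuot Γ) = transSum s' l := by
  unfold transSum
  congr 1
  exact List.map_congr_left fun p hp => by rw [h p hp]

theorem transSum_map {s s' : StackExp A → StExp A} {F : StackExp A → StackExp A}
    {l : List (Option A × StackExp A)} {x : MilQuot Γ}
    (h : ∀ E, mk (s (F E)) = mk (s' E) * x) :
    transSum s (l.map fun p => (p.1, F p.2)) = transSum s' l * x := by
  unfold transSum
  rw [sum_mul, List.map_map, List.map_map]
  congr 1
  refine List.map_congr_left fun p _ => ?_
  simp [h, mul_assoc]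

theorem transSum_ite (s : StackExp A → StExp A) (b : Bool) (l : List (Option A × StackExp A)) :
    (transSum s (if b then l else []) : MilQuot Γ) = ofTerm b * transSum s l := by
  cases b
  · simp [ofTerm, transSum, MilQuot.zero_mul]
  · simp [ofTerm]

theorem ofTerm_or (b c : Bool) : (ofTerm (b || c) : MilQuot Γ) = ofTerm b + ofTerm c := by
  cases b <;> cases c <;> simp [ofTerm, MilQuot.add_self]

theorem ofTerm_and (b c : Bool) : (ofTerm (b && c) : MilQuot Γ) = ofTerm b * ofTerm c := by
  cases b <;> cases c <;> simp [ofTerm, MilQuot.zero_mul]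

end MilQuot

open MilQuot

/-- Every star expression is provably the sum of its termination constant and its derivatives. For
an iteration `e*` where `e` terminates, this uses the axiom `(1 + x)* = x*`. -/
theorem StExp.mk_eq_transSum (e : StExp A) :
    (mk e : MilQuot Γ) = ofTerm e.termb + transSum StackExp.proj e.succ := by
  induction e with
  | zero => simp [ofTerm, transSum, StExp.termb, StExp.succ]
  | one => simp [ofTerm, transSum, StExp.termb, StExp.succ]
  | act a => simp [ofTerm, transSum, StExp.termb, StExp.succ, labelExp, StackExp.proj]
  | add e f ihe ihf =>
    rw [mk_add, StExp.termb, StExp.succ, ofTerm_or, transSum_append, ihe, ihf,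
      add_add_add_comm]
  | mul e f ihe ihf =>
    rw [mk_mul, StExp.termb, StExp.succ, ofTerm_and, transSum_append, transSum_ite,
      transSum_map (F := (StackExp.mul · f)) (s' := StackExp.proj) (x := mk f) fun _ => rfl]
    rw [ihe, add_mul]
    cases e.termb
    · simp [ofTerm, MilQuot.zero_mul]
    · simp only [ofTerm, if_true, one_mul]
      nth_rw 1 [ihf]
      rw [ofTerm]
      abel
  | star e ih =>
    rw [mk_star, StExp.termb, StExp.succ,
      transSum_map (F := (StackExp.stk · e)) (s' := StackExp.proj) (x := (mk e).star) fun _ => rfl]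
    have hs : (mk e : MilQuot Γ).star = (transSum StackExp.proj e.succ).star := by
      rw [ih]
      cases e.termb
      · simp [ofTerm]
      · exact star_one_add _
    rw [hs]
    exact star_eq _

theorem StackExp.mk_eq_transSum (E : StackExp A) :
    (mk E.proj : MilQuot Γ) = ofTerm E.termb + transSum StackExp.proj E.succ := by
  induction E with
  | zero => exact StExp.mk_eq_transSum .zero
  | one => exact StExp.mk_eq_transSum .one
  | act a => exact StExp.mk_eq_transSum (.act a)
  | add e f => exact StExp.mk_eq_transSum (.add e f)
  | star e => exact StExp.mk_eq_transSum (.star e)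
  | mul E f ih =>
    rw [StackExp.proj, mk_mul, StackExp.termb, StackExp.succ, ofTerm_and, transSum_append,
      transSum_ite, transSum_map (F := (StackExp.mul · f)) (s' := StackExp.proj)
        (x := mk f) fun _ => rfl, ih, add_mul]
    cases E.termb
    · simp [ofTerm, MilQuot.zero_mul]
    · simp only [ofTerm, if_true, one_mul]
      nth_rw 1 [StExp.mk_eq_transSum f]
      rw [ofTerm]
      abel
  | stk E e ih =>
    rw [StackExp.proj, mk_mul, StackExp.termb, StackExp.succ, transSum_append,
      transSum_ite, transSum_map (F := (StackExp.stk · e)) (s' := StackExp.proj)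
        (x := mk (.star e)) fun _ => rfl, ih,
      add_mul]
    simp [ofTerm, transSum, labelExp, StackExp.proj, add_comm]

end Solution

/-! ### The 1-chart interpretation as a finite 1-chart -/

section Interpretation

variable {A : Type u}

/-- The stacked star expressions that are reached from a star expression by at least one
transition. -/
def StExp.derivs : StExp A → List (StackExp A)
  | .zero => []
  | .one => []
  | .act _ => [.one]
  | .add e f => e.derivs ++ f.derivs
  | .mul e f => e.derivs.map (StackExp.mul · f) ++
      if e.termb || e.derivs.any StackExp.termb then f.derivs else []
  | .star e => e.derivs.map (StackExp.stk · e) ++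
      if e.derivs.any StackExp.termb then [.star e] else []

theorem StExp.mem_derivs_of_step {e : StExp A} {α : Option A} {E : StackExp A}
    (h : StackStep e.toStack α E) : E ∈ e.derivs := by
  induction e generalizing α E with
  | zero => cases h
  | one => cases h
  | act a => cases h; exact List.mem_singleton.2 rfl
  | add e f ihe ihf =>
    cases h with
    | addL h => exact List.mem_append.2 (.inl (ihe h))
    | addR h => exact List.mem_append.2 (.inr (ihf h))
  | mul e f ihe ihf =>
    cases h with
    | mulL h => exact List.mem_append.2 (.inl (List.mem_map_of_mem (ihe h)))
    | mulR ht h =>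
      rw [← StackExp.termb_iff, StExp.termb_toStack] at ht
      simp [StExp.derivs, ht, ihf h]
  | star e ih =>
    cases h with
    | star h => exact List.mem_append.2 (.inl (List.mem_map_of_mem (ih h)))

theorem StExp.mem_derivs_of_mem_of_step {e : StExp A} {α : Option A} {E E' : StackExp A}
    (hE : E ∈ e.derivs) (h : StackStep E α E') : E' ∈ e.derivs := by
  induction e generalizing α E E' with
  | zero => cases hE
  | one => cases hE
  | act a => cases List.mem_singleton.1 hE; cases h
  | add e f ihe ihf =>
    rcases List.mem_append.1 hE with hE | hE
    · exact List.mem_append.2 (.inl (ihe hE h))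
    · exact List.mem_append.2 (.inr (ihf hE h))
  | mul e f ihe ihf =>
    rcases List.mem_append.1 hE with hE | hE
    · obtain ⟨F, hF, rfl⟩ := List.mem_map.1 hE
      cases h with
      | mulL h => exact List.mem_append.2 (.inl (List.mem_map_of_mem (ihe hF h)))
      | mulR ht h =>
        have : e.derivs.any StackExp.termb = true :=
          List.any_eq_true.2 ⟨F, hF, (StackExp.termb_iff F).2 ht⟩
        simp [StExp.derivs, this, StExp.mem_derivs_of_step h]
    · refine List.mem_append.2 (.inr ?_)
      split_ifs at hE ⊢
      · exact ihf hE h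
      · cases hE
  | star e ih =>
    rcases List.mem_append.1 hE with hE | hE
    · obtain ⟨F, hF, rfl⟩ := List.mem_map.1 hE
      cases h with
      | stkL h => exact List.mem_append.2 (.inl (List.mem_map_of_mem (ih hF h)))
      | stkOne ht =>
        have : e.derivs.any StackExp.termb = true :=
          List.any_eq_true.2 ⟨F, hF, (StackExp.termb_iff F).2 ht⟩
        simp [StExp.derivs, this]
    · split_ifs at hE
      · cases List.mem_singleton.1 hE
        exact StExp.mem_derivs_of_step (e := .star e) h
      · cases hE

theorem StExp.transGen_of_mem_derivs {e : StExp A} {E : StackExp A} (h : E ∈ e.derivs) :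
    TransGen (fun F F' => ∃ α, StackStep F α F') e.toStack E := by
  induction e generalizing E with
  | zero => cases h
  | one => cases h
  | act a => cases List.mem_singleton.1 h; exact .single ⟨_, .act a⟩
  | add e f ihe ihf =>
    rcases List.mem_append.1 h with h | h
    · obtain ⟨F, ⟨α, hα⟩, hF⟩ := TransGen.head'_iff.1 (ihe h)
      obtain ⟨a, rfl⟩ := StExp.exists_label_of_step hα
      exact .head' ⟨_, .addL hα⟩ hF
    · obtain ⟨F, ⟨α, hα⟩, hF⟩ := TransGen.head'_iff.1 (ihf h)
      obtain ⟨a, rfl⟩ := StExp.exists_label_of_step hα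
      exact .head' ⟨_, .addR hα⟩ hF
  | mul e f ihe ihf =>
    rcases List.mem_append.1 h with h | h
    · obtain ⟨F, hF, rfl⟩ := List.mem_map.1 h
      exact (ihe hF).lift (StackExp.mul · f) fun _ _ ⟨α, hα⟩ => ⟨α, .mulL hα⟩
    · split_ifs at h with ht
      · have hex : ∃ F, F.termb = true ∧
            ReflTransGen (fun F F' => ∃ α, StackStep F α F') e.toStack F := by
          rcases Bool.or_eq_true_iff.1 ht with ht | ht
          · exact ⟨_, (StExp.termb_toStack e).trans ht, .refl⟩
          · obtain ⟨F, hF, hFt⟩ := List.any_eq_true.1 ht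
            exact ⟨F, hFt, (ihe hF).to_reflTransGen⟩
        obtain ⟨F, hFt, hF⟩ := hex
        obtain ⟨G, ⟨α, hα⟩, hG⟩ := TransGen.head'_iff.1 (ihf h)
        obtain ⟨a, rfl⟩ := StExp.exists_label_of_step hα
        exact TransGen.trans_right
          (hF.lift (StackExp.mul · f) fun _ _ ⟨α, hα⟩ => ⟨α, .mulL hα⟩)
          (.head' ⟨_, .mulR ((StackExp.termb_iff F).1 hFt) hα⟩ hG)
      · cases h
  | star e ih =>
    have key (F : StackExp A) (hF : F ∈ e.derivs) :
        TransGen (fun F F' => ∃ α, StackStep F α F') (.star e) (.stk F e) := by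
      obtain ⟨G, ⟨α, hα⟩, hG⟩ := TransGen.head'_iff.1 (ih hF)
      obtain ⟨a, rfl⟩ := StExp.exists_label_of_step hα
      exact .head' ⟨_, .star hα⟩
        (hG.lift (StackExp.stk · e) fun _ _ ⟨α, hα⟩ => ⟨α, .stkL hα⟩)
    rcases List.mem_append.1 h with h | h
    · obtain ⟨F, hF, rfl⟩ := List.mem_map.1 h
      exact key F hF
    · split_ifs at h with ht
      · cases List.mem_singleton.1 h
        obtain ⟨F, hF, hFt⟩ := List.any_eq_true.1 ht
        exact (key F hF).tail ⟨none, .stkOne ((StackExp.termb_iff F).1 hFt)⟩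
      · cases h

theorem StExp.mem_cons_derivs {e : StExp A} {E : StackExp A} :
    E ∈ e.toStack :: e.derivs ↔ StackReach e.toStack E := by
  constructor
  · intro h
    rcases List.mem_cons.1 h with rfl | h
    · exact .refl
    · exact (StExp.transGen_of_mem_derivs h).to_reflTransGen
  · intro h
    refine List.mem_cons.2 ?_
    induction h with
    | refl => exact .inl rfl
    | tail _ h ih =>
      obtain ⟨α, hα⟩ := h
      rcases ih with rfl | ih
      · exact .inr (StExp.mem_derivs_of_step hα)
      · exact .inr (StExp.mem_derivs_of_mem_of_step ih hα)

/-- All transitions from the stacked star expressions in a list. -/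
def transList (l : List (StackExp A)) : List (StackExp A × Option A × StackExp A) :=
  l.flatMap fun E => E.succ.map fun p => (E, p.1, p.2)

theorem mem_transList {l : List (StackExp A)} {E : StackExp A} {α : Option A}
    {E' : StackExp A} : (E, α, E') ∈ transList l ↔ E ∈ l ∧ StackStep E α E' := by
  simp only [transList, List.mem_flatMap, List.mem_map, Prod.exists, StackExp.mem_succ,
    Prod.mk.injEq]
  constructor
  · rintro ⟨_, h, _, _, hs, rfl, rfl, rfl⟩
    exact ⟨h, hs⟩
  · rintro ⟨h, hs⟩
    exact ⟨_, h, _, _, hs, rfl, rfl, rfl⟩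

/-- The 1-chart interpretation of a star expression. -/
def StExp.chart (e : StExp A) : OneChart A (StackExp A) where
  verts := e.toStack :: e.derivs
  start := e.toStack
  trans := transList (e.toStack :: e.derivs)
  term := (e.toStack :: e.derivs).filter StackExp.termb
  start_mem := List.mem_cons_self
  trans_mem := by
    rintro ⟨E, α, E'⟩ h
    obtain ⟨h, hs⟩ := mem_transList.1 h
    exact ⟨h, StExp.mem_cons_derivs.2 ((StExp.mem_cons_derivs.1 h).tail ⟨α, hs⟩)⟩
  term_mem := fun _ h => (List.mem_filter.1 h).1

theorem StExp.isInterpretation_chart (e : StExp A) : e.chart.IsInterpretation e := by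
  refine ⟨rfl, fun E => StExp.mem_cons_derivs, fun E α E' => ?_, fun E => ?_⟩
  · exact mem_transList.trans (and_congr_left' StExp.mem_cons_derivs)
  · exact List.mem_filter.trans (and_congr StExp.mem_cons_derivs (StackExp.termb_iff E))

theorem StExp.llee_chart (e : StExp A) : e.chart.LLEE :=
  OneChart.llee_of_stackStep (fun _ _ _ h => (mem_transList.1 h).2)
    fun E h => (StackExp.termb_iff E).1 (List.mem_filter.1 h).2

theorem StExp.weaklyGuarded_chart (e : StExp A) : e.chart.WeaklyGuarded :=
  OneChart.weaklyGuarded_of_stackStep fun _ _ _ h => (mem_transList.1 h).2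

open MilQuot in
/-- Being a solution of the 1-chart interpretation is an equation in the algebra of star
expressions modulo provable equality. -/
theorem StExp.isSolutionAt_chart {Γ : Set (StExp A × StExp A)} {e : StExp A}
    {s : StackExp A → StExp A} {E : StackExp A} (hE : E ∈ e.chart.verts)
    (h : (mk (s E) : MilQuot Γ) = ofTerm E.termb + transSum s E.succ) :
    e.chart.IsSolutionAt (MilMinusProv Γ) s E := by
  intro l hl
  rw [← MilQuot.mk_eq, mk_add, mk_sum, h]
  congr 1
  · have hmem : E ∈ e.chart.term ↔ E.termb = true :=
      List.mem_filter.trans (and_iff_right hE)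
    unfold OneChart.termConst ofTerm
    by_cases ht : E.termb = true
    · rw [if_pos ht, if_pos (hmem.2 ht), mk_one]
    · rw [if_neg ht, if_neg (mt hmem.1 ht), mk_zero]
  · have hl' : ∀ p, p ∈ E.succ ↔ p ∈ l := fun ⟨α, E'⟩ =>
      StackExp.mem_succ.trans (((hl α E').trans
        (mem_transList.trans (and_iff_right hE))).symm)
    rw [transSum, List.map_map]
    refine sum_congr fun x => ?_
    simp only [List.mem_map, hl']
    rfl

end Interpretation

/-! ### The coinductive proof for an instance of `RSP*` -/

section RSP

variable {A : Type u}

/-- The nesting depth of products to the right, disregarding the left factors of products. -/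
def StExp.tailDepth : StExp A → ℕ
  | .zero => 0
  | .one => 0
  | .act _ => 0
  | .add e f => max e.tailDepth f.tailDepth
  | .mul _ f => f.tailDepth + 1
  | .star _ => 0

/-- The nesting depth of products to the right, for stacked star expressions. -/
def StackExp.tailDepth : StackExp A → ℕ
  | .zero => 0
  | .one => 0
  | .act _ => 0
  | .add e f => max e.tailDepth f.tailDepth
  | .mul _ f => f.tailDepth + 1
  | .star _ => 0
  | .stk _ _ => 0

theorem StExp.tailDepth_toStack (e : StExp A) : e.toStack.tailDepth = e.tailDepth := by
  cases e <;> rfl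

theorem StackStep.tailDepth_le {E E' : StackExp A} {α : Option A} (h : StackStep E α E') :
    E'.tailDepth ≤ E.tailDepth := by
  induction h with
  | act _ => exact le_rfl
  | addL _ ih => exact ih.trans ((StExp.tailDepth_toStack _).trans_le (le_max_left _ _))
  | addR _ ih => exact ih.trans ((StExp.tailDepth_toStack _).trans_le (le_max_right _ _))
  | star _ => exact le_rfl
  | mulL _ _ => exact le_rfl
  | stkL _ _ => exact le_rfl
  | mulR _ _ ih => exact ih.trans ((StExp.tailDepth_toStack _).trans_le (Nat.le_succ _))
  | stkOne _ => exact le_rfl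

theorem StExp.tailDepth_le_of_mem_derivs {e : StExp A} {E : StackExp A} (h : E ∈ e.derivs) :
    E.tailDepth ≤ e.tailDepth := by
  rw [← StExp.tailDepth_toStack e]
  have hr := StExp.transGen_of_mem_derivs h
  clear h
  induction hr with
  | single h => exact h.choose_spec.tailDepth_le
  | tail _ h ih => exact h.choose_spec.tailDepth_le.trans ih

/-- The left-hand sides of the coinductive proof of `e = f* · g` from `e = f · e + g`: the vertices
`f* · g` and `(F ⋆ f*) · g` are labeled by `e` and `F · e`, and the derivatives of `g` by
themselves, up to reading `⋆` as the product. The tail depths of `h` and `g` decide whether a vertex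
`E · h` is of one of the former two kinds, since the right factor of a derivative of `g` has smaller
tail depth than `g`. The value `0` is taken only outside of the 1-chart. -/
def rspLhs (e g : StExp A) : StackExp A → StExp A
  | .mul E h =>
      if h.tailDepth = g.tailDepth then
        match E with
        | .star _ => e
        | .stk F _ => .mul F.proj e
        | _ => .zero
      else .mul E.proj h
  | E => E.proj

theorem rspLhs_mul_star (e f g : StExp A) : rspLhs e g (.mul (.star f) g) = e := by
  simp [rspLhs]

theorem rspLhs_mul_stk (e f g : StExp A) (F : StackExp A) :
    rspLhs e g (.mul (.stk F f) g) = .mul F.proj e := by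
  simp [rspLhs]

theorem rspLhs_of_tailDepth_le {e g : StExp A} {E : StackExp A}
    (h : E.tailDepth ≤ g.tailDepth) : rspLhs e g E = E.proj := by
  cases E with
  | mul E k => exact if_neg (ne_of_lt h)
  | _ => rfl

open MilQuot

theorem isSolution_proj (Γ : Set (StExp A × StExp A)) (e : StExp A) :
    e.chart.IsSolution (MilMinusProv Γ) StackExp.proj := fun E hE =>
  StExp.isSolutionAt_chart hE E.mk_eq_transSum

/-- The premise `e = f · e + g` is used at the start vertex `f* · g`; since `f` does not terminate
immediately, `f` is there the sum of its derivatives. -/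
theorem isSolution_rspLhs {e f g : StExp A} (hf : ¬ f.Term) :
    (StExp.mul (StExp.star f) g).chart.IsSolution
      (MilMinusProv {(e, StExp.add (StExp.mul f e) g)}) (rspLhs e g) := by
  have hfb : f.termb = false := Bool.eq_false_iff.2 (mt (StExp.termb_iff f).1 hf)
  have hyp : (mk e : MilQuot {(e, StExp.add (StExp.mul f e) g)}) = mk f * mk e + mk g :=
    MilQuot.mk_eq.2 (.hyp rfl)
  have hstart : (mk (rspLhs e g (.mul (.star f) g)) :
      MilQuot {(e, StExp.add (StExp.mul f e) g)}) =
      ofTerm (StackExp.mul (.star f) g).termb +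
        transSum (rspLhs e g) (StackExp.mul (.star f) g).succ := by
    have hg : (transSum (rspLhs e g) g.succ : MilQuot {(e, StExp.add (StExp.mul f e) g)}) =
        transSum StackExp.proj g.succ := transSum_congr fun p hp =>
      rspLhs_of_tailDepth_le
        (StExp.tailDepth_le_of_mem_derivs (StExp.mem_derivs_of_step (StExp.mem_succ.1 hp)))
    simp only [StackExp.termb, StackExp.succ, List.map_map, Bool.true_and, if_true]
    rw [transSum_append, hg, rspLhs_mul_star]
    rw [show (fun p => (p.1, StackExp.mul p.2 g)) ∘ (fun p => (p.1, StackExp.stk p.2 f)) =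
      fun p : Option A × StackExp A => (p.1, (fun E => StackExp.mul (.stk E f) g) p.2) from rfl]
    rw [transSum_map (F := fun E => StackExp.mul (.stk E f) g) (s' := StackExp.proj) (x := mk e)
        fun E => by
      rw [rspLhs_mul_stk, mk_mul]]
    conv_lhs => rw [hyp, f.mk_eq_transSum, g.mk_eq_transSum, hfb]
    simp only [ofTerm, Bool.false_eq_true, if_false, zero_add]
    abel
  intro E hE
  refine StExp.isSolutionAt_chart hE ?_
  rcases List.mem_cons.1 hE with rfl | hE
  · exact hstart
  rcases List.mem_append.1 hE with hE | hE
  · obtain ⟨E, hE', rfl⟩ := List.mem_map.1 hE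
    rcases List.mem_append.1 hE' with hE | hE
    · obtain ⟨F, -, rfl⟩ := List.mem_map.1 hE
      simp only [StackExp.termb, StackExp.succ, List.map_map, List.map_append, Bool.false_and,
        Bool.false_eq_true, if_false, List.append_nil, apply_ite (List.map _)]
      rw [transSum_append, rspLhs_mul_stk]
      rw [show (fun p => (p.1, StackExp.mul p.2 g)) ∘ (fun p => (p.1, StackExp.stk p.2 f)) =
        fun p : Option A × StackExp A => (p.1, (fun E => StackExp.mul (.stk E f) g) p.2) from rfl]
      rw [transSum_map (F := fun E => StackExp.mul (.stk E f) g) (s' := StackExp.proj) (x := mk e)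
        fun E => by
        rw [rspLhs_mul_stk, mk_mul]]
      rw [mk_mul, F.mk_eq_transSum, add_mul, List.map_nil, transSum_ite]
      simp [ofTerm, transSum, labelExp, rspLhs_mul_star, add_comm]
    · split_ifs at hE
      · cases List.mem_singleton.1 hE
        exact hstart
      · cases hE
  · have hE : E ∈ g.derivs := by
      split_ifs at hE
      · exact hE
      · cases hE
    have hs : ∀ E ∈ g.derivs, rspLhs e g E = E.proj := fun E hE =>
      rspLhs_of_tailDepth_le (StExp.tailDepth_le_of_mem_derivs hE)
    rw [hs E hE, E.mk_eq_transSum]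
    congr 1
    exact transSum_congr fun p hp =>
      (hs _ (StExp.mem_derivs_of_mem_of_step hE (StackExp.mem_succ.1 hp))).symm

/-- The LLEE-witnessed coinductive proof of `e = f* · g` over `Mil⁻ + {e = f · e + g}`, on the
1-chart interpretation of `f* · g`. -/
def rspCoindProof {e f g : StExp A} (hf : ¬ f.Term) :
    LLEECoindProof (StackExp A) {(e, StExp.add (StExp.mul f e) g)} e
      (StExp.mul (StExp.star f) g) where
  chart := (StExp.mul (StExp.star f) g).chart
  lhs := rspLhs e g
  rhs := StackExp.proj
  weaklyGuarded := StExp.weaklyGuarded_chart _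
  llee := StExp.llee_chart _
  lhs_solution := isSolution_rspLhs hf
  rhs_solution := isSolution_proj _ _
  lhs_start := rspLhs_mul_star e f g
  rhs_start := StExp.proj_toStack _

/-- The transformation of derivations in `Mil` into derivations in `cMil₁`. -/
def MilDeriv.toCMil {e f : StExp A} : MilDeriv e f → CMilOneDeriv (StackExp A) e f
  | .ax h => .ax h
  | .refl e => .refl e
  | .symm D => .symm D.toCMil
  | .trans D₁ D₂ => .trans D₁.toCMil D₂.toCMil
  | .cxt C D => .cxt C D.toCMil
  | .rsp hf D => .lcoind D.toCMil (rspCoindProof hf)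

theorem MilDeriv.mimics_toCMil {e f : StExp A} (D : MilDeriv e f) : Mimics D D.toCMil := by
  induction D with
  | ax h => exact .ax h
  | refl e => exact .refl e
  | symm D ih => exact .symm ih
  | trans D₁ D₂ ih₁ ih₂ => exact .trans ih₁ ih₂
  | cxt C D ih => exact .cxt C ih
  | rsp hf D ih => exact .rsp hf _ ih (StExp.isInterpretation_chart _)

end RSP

/-! ### Primitive recursion on codes of trees -/

section CodeRecursion

variable {σ : Type*}

theorem Primrec.ite_eq {α : Type*} [Primcodable α] [Primcodable σ] {t s : α → ℕ} {f g : α → σ}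
    (ht : Primrec t) (hs : Primrec s) (hf : Primrec f) (hg : Primrec g) :
    Primrec fun a => if t a = s a then f a else g a :=
  Primrec.ite (Primrec.eq.comp ht hs) hf hg

theorem Primrec.ite_bool {α : Type*} [Primcodable α] [Primcodable σ] {b : α → Bool}
    {f g : α → σ} (hb : Primrec b) (hf : Primrec f) (hg : Primrec g) :
    Primrec fun a => if b a then f a else g a :=
  Primrec.ite (Primrec.eq.comp hb (.const true)) hf hg

theorem Primrec.list_any {α : Type*} [Primcodable α] {p : α → Bool} (hp : Primrec p) :
    Primrec fun l : List α => l.any p := by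
  refine (Primrec.list_foldr (h := fun _ q => p q.1 || q.2) Primrec.id (.const false)
    (Primrec.or.comp (hp.comp (Primrec.fst.comp Primrec.snd))
      (Primrec.snd.comp Primrec.snd))).of_eq fun l => ?_
  induction l with
  | nil => rfl
  | cons a l ih =>
    rw [List.any_cons, ← ih]
    rfl

/-- The list of the first `n` values of the function defined from `G` by course-of-values
recursion. -/
def codeTable (G : ℕ → List σ → σ) (n : ℕ) : List σ :=
  Nat.rec [] (fun k l => l ++ [G k l]) n

/-- The function defined by course-of-values recursion, where `G` obtains the argument and the list
of all previous values. -/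
def codeRec (G : ℕ → List σ → σ) (n : ℕ) : σ :=
  G n (codeTable G n)

theorem codeTable_eq (G : ℕ → List σ → σ) (n : ℕ) :
    codeTable G n = (List.range n).map (codeRec G) := by
  induction n with
  | zero => rfl
  | succ n ih =>
    rw [List.range_succ, List.map_append, ← ih]
    rfl

theorem codeTable_getD (G : ℕ → List σ → σ) (d : σ) {m n : ℕ} (h : m < n) :
    (codeTable G n).getD m d = codeRec G m := by
  simp [codeTable_eq, h]

theorem Primrec.codeRec [Primcodable σ] {G : ℕ → List σ → σ} (hG : Primrec₂ G) :
    Primrec (codeRec G) := by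
  have hf : Primrec₂ fun (k : ℕ) (l : List σ) => l ++ [G k l] :=
    Primrec.list_concat.comp Primrec.snd hG
  exact hG.comp Primrec.id (Primrec.nat_rec₁ [] hf)

theorem Nat.lt_pair_of_pos {t p : ℕ} (ht : 0 < t) : p < Nat.pair t p := by
  rw [Nat.pair]
  split_ifs <;> nlinarith

/-- Recursion on codes of trees: at the code `⟨t, p⟩` of a tree with tag `t` and payload `p`, the
step function `H` is applied to `t` and `p`, and to the values at `p` and at the two components
of `p`. -/
def codeFold (d : σ) (H : ℕ × ℕ × σ × σ × σ → σ) : ℕ → σ :=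
  codeRec fun n l => H (n.unpair.1, n.unpair.2, l.getD n.unpair.2 d,
    l.getD n.unpair.2.unpair.1 d, l.getD n.unpair.2.unpair.2 d)

theorem codeFold_pair (d : σ) (H : ℕ × ℕ × σ × σ × σ → σ) {t p : ℕ} (ht : 0 < t) :
    codeFold d H (Nat.pair t p) = H (t, p, codeFold d H p, codeFold d H p.unpair.1,
      codeFold d H p.unpair.2) := by
  have hp : p < Nat.pair t p := Nat.lt_pair_of_pos ht
  have h₁ : p.unpair.1 < Nat.pair t p := (Nat.unpair_left_le p).trans_lt hp
  have h₂ : p.unpair.2 < Nat.pair t p := (Nat.unpair_right_le p).trans_lt hp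
  conv_lhs => rw [codeFold, codeRec]
  rw [Nat.unpair_pair, codeTable_getD _ _ hp, codeTable_getD _ _ h₁, codeTable_getD _ _ h₂]
  rfl

theorem Primrec.unpair_fst {α : Type*} [Primcodable α] {f : α → ℕ} (hf : Primrec f) :
    Primrec fun a => (f a).unpair.1 :=
  Primrec.fst.comp (Primrec.unpair.comp hf)

theorem Primrec.unpair_snd {α : Type*} [Primcodable α] {f : α → ℕ} (hf : Primrec f) :
    Primrec fun a => (f a).unpair.2 :=
  Primrec.snd.comp (Primrec.unpair.comp hf)

theorem Primrec.codeFold [Primcodable σ] (d : σ) {H : ℕ × ℕ × σ × σ × σ → σ}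
    (hH : Primrec H) : Primrec (codeFold d H) := by
  have h₁ : Primrec fun q : ℕ × List σ => q.1.unpair.1 := .unpair_fst .fst
  have h₂ : Primrec fun q : ℕ × List σ => q.1.unpair.2 := .unpair_snd .fst
  have hget {f : ℕ × List σ → ℕ} (hf : Primrec f) :
      Primrec fun q : ℕ × List σ => q.2.getD (f q) d :=
    (Primrec.list_getD d).comp .snd hf
  exact Primrec.codeRec (hH.comp (h₁.pair (h₂.pair ((hget h₂).pair
    ((hget h₂.unpair_fst).pair (hget h₂.unpair_snd))))))

theorem Primrec.natPair {α : Type*} [Primcodable α] {f g : α → ℕ} (hf : Primrec f)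
    (hg : Primrec g) : Primrec fun a => Nat.pair (f a) (g a) :=
  Primrec₂.natPair.comp hf hg

end CodeRecursion

/-! ### Operations on codes of expressions -/

section CodeOperations

/-- `StackExp.termb` on codes. -/
def termCode : ℕ → Bool :=
  codeFold false fun q =>
    if q.1 = 2 then true
    else if q.1 = 4 then q.2.2.2.1 || q.2.2.2.2
    else if q.1 = 5 then q.2.2.2.1 && q.2.2.2.2
    else if q.1 = 6 then true
    else false

/-- `StackExp.proj` on codes. -/
def projCode : ℕ → ℕ :=
  codeFold 0 fun q =>
    if q.1 = 5 then Nat.pair 5 (Nat.pair q.2.2.2.1 q.2.1.unpair.2)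
    else if q.1 = 7 then Nat.pair 5 (Nat.pair q.2.2.2.1 (Nat.pair 6 q.2.1.unpair.2))
    else Nat.pair q.1 q.2.1

/-- `StExp.tailDepth` on codes. -/
def tailDepthCode : ℕ → ℕ :=
  codeFold 0 fun q =>
    if q.1 = 4 then max q.2.2.2.1 q.2.2.2.2
    else if q.1 = 5 then q.2.2.2.2 + 1
    else 0

/-- The step function of the recursion for `StackExp.succ` on codes. -/
def succStep
    (q : ℕ × ℕ × List (Option ℕ × ℕ) × List (Option ℕ × ℕ) × List (Option ℕ × ℕ)) :
    List (Option ℕ × ℕ) :=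
  if q.1 = 3 then [(some q.2.1, Nat.pair 2 0)]
  else if q.1 = 4 then q.2.2.2.1 ++ q.2.2.2.2
  else if q.1 = 5 then
    q.2.2.2.1.map (fun p => (p.1, Nat.pair 5 (Nat.pair p.2 q.2.1.unpair.2))) ++
      if termCode q.2.1.unpair.1 then q.2.2.2.2 else []
  else if q.1 = 6 then q.2.2.1.map fun p => (p.1, Nat.pair 7 (Nat.pair p.2 q.2.1))
  else if q.1 = 7 then
    q.2.2.2.1.map (fun p => (p.1, Nat.pair 7 (Nat.pair p.2 q.2.1.unpair.2))) ++
      if termCode q.2.1.unpair.1 then [(none, Nat.pair 6 q.2.1.unpair.2)] else []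
  else []

/-- `StackExp.succ` on codes. -/
def succCode : ℕ → List (Option ℕ × ℕ) :=
  codeFold [] succStep

theorem succCode_pair {t p : ℕ} (ht : 0 < t) :
    succCode (Nat.pair t p) = succStep (t, p, succCode p, succCode p.unpair.1,
      succCode p.unpair.2) :=
  codeFold_pair _ _ ht

/-- The step function of the recursion for `StExp.derivs` on codes. -/
def derivsStep (q : ℕ × ℕ × List ℕ × List ℕ × List ℕ) : List ℕ :=
  if q.1 = 3 then [Nat.pair 2 0]
  else if q.1 = 4 then q.2.2.2.1 ++ q.2.2.2.2
  else if q.1 = 5 then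
    q.2.2.2.1.map (fun n => Nat.pair 5 (Nat.pair n q.2.1.unpair.2)) ++
      if termCode q.2.1.unpair.1 || q.2.2.2.1.any termCode then q.2.2.2.2 else []
  else if q.1 = 6 then
    q.2.2.1.map (fun n => Nat.pair 7 (Nat.pair n q.2.1)) ++
      if q.2.2.1.any termCode then [Nat.pair 6 q.2.1] else []
  else []

/-- `StExp.derivs` on codes. -/
def derivsCode : ℕ → List ℕ :=
  codeFold [] derivsStep

theorem derivsCode_pair {t p : ℕ} (ht : 0 < t) :
    derivsCode (Nat.pair t p) = derivsStep (t, p, derivsCode p, derivsCode p.unpair.1,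
      derivsCode p.unpair.2) :=
  codeFold_pair _ _ ht

/-- `transList` on codes. -/
def transListCode (l : List ℕ) : List (ℕ × Option ℕ × ℕ) :=
  l.flatMap fun n => (succCode n).map fun p => (n, p.1, p.2)

/-- `rspLhs` on codes: `q` consists of the codes of `e`, of `g`, and of the vertex. -/
def rspLhsCode (q : ℕ × ℕ × ℕ) : ℕ :=
  if q.2.2.unpair.1 = 5 then
    if tailDepthCode q.2.2.unpair.2.unpair.2 = tailDepthCode q.2.1 then
      if q.2.2.unpair.2.unpair.1.unpair.1 = 6 then q.1
      else if q.2.2.unpair.2.unpair.1.unpair.1 = 7 then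
        Nat.pair 5 (Nat.pair (projCode q.2.2.unpair.2.unpair.1.unpair.2.unpair.1) q.1)
      else Nat.pair 1 0
    else Nat.pair 5 (Nat.pair (projCode q.2.2.unpair.2.unpair.1) q.2.2.unpair.2.unpair.2)
  else projCode q.2.2

/-- The code of the coinductive proof of `e = f* · g`, computed from the codes of `e` and of
`f* · g`. -/
def rspProofCode (q : ℕ × ℕ) : ℕ :=
  Nat.pair
    (Encodable.encode (q.2 :: derivsCode q.2, q.2, transListCode (q.2 :: derivsCode q.2),
      (q.2 :: derivsCode q.2).filter termCode))
    (Encodable.encode ((q.2 :: derivsCode q.2).map fun n =>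
      (n, rspLhsCode (q.1, q.2.unpair.2.unpair.2, n), projCode n)))

/-- The transformation of derivations on codes. -/
def toCMilCode : ℕ → ℕ :=
  codeRec fun n l =>
    if n.unpair.1 = 3 then
      Nat.pair 3 (Nat.pair n.unpair.2.unpair.1 (l.getD n.unpair.2.unpair.2 0))
    else if n.unpair.1 = 4 then
      Nat.pair 4 (Nat.pair n.unpair.2.unpair.1 (Nat.pair
        (l.getD n.unpair.2.unpair.2.unpair.1 0) (l.getD n.unpair.2.unpair.2.unpair.2 0)))
    else if n.unpair.1 = 5 then
      Nat.pair 5 (Nat.pair n.unpair.2.unpair.1 (Nat.pair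
        n.unpair.2.unpair.2.unpair.1 (l.getD n.unpair.2.unpair.2.unpair.2 0)))
    else if n.unpair.1 = 6 then
      Nat.pair 6 (Nat.pair n.unpair.2.unpair.1 (Nat.pair
        (l.getD n.unpair.2.unpair.2 0) (rspProofCode n.unpair.2.unpair.1.unpair)))
    else n

theorem toCMilCode_pair {t q b : ℕ} (ht : 0 < t) :
    toCMilCode (Nat.pair t (Nat.pair q b)) =
      if t = 3 then Nat.pair 3 (Nat.pair q (toCMilCode b))
      else if t = 4 then Nat.pair 4 (Nat.pair q (Nat.pair
        (toCMilCode b.unpair.1) (toCMilCode b.unpair.2)))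
      else if t = 5 then Nat.pair 5 (Nat.pair q (Nat.pair
        b.unpair.1 (toCMilCode b.unpair.2)))
      else if t = 6 then Nat.pair 6 (Nat.pair q (Nat.pair
        (toCMilCode b) (rspProofCode q.unpair)))
      else Nat.pair t (Nat.pair q b) := by
  have hb : b < Nat.pair t (Nat.pair q b) :=
    (Nat.right_le_pair q b).trans_lt (Nat.lt_pair_of_pos ht)
  have h₁ := (Nat.unpair_left_le b).trans_lt hb
  have h₂ := (Nat.unpair_right_le b).trans_lt hb
  conv_lhs => rw [toCMilCode, codeRec]
  simp only [Nat.unpair_pair, codeTable_getD _ _ hb, codeTable_getD _ _ h₁,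
    codeTable_getD _ _ h₂]
  rfl

section Primrec

variable {σ : Type*} [Primcodable σ]

theorem primrec_tag : Primrec fun q : ℕ × ℕ × σ × σ × σ => q.1 := .fst
theorem primrec_payload : Primrec fun q : ℕ × ℕ × σ × σ × σ => q.2.1 := Primrec.fst.comp .snd
theorem primrec_value : Primrec fun q : ℕ × ℕ × σ × σ × σ => q.2.2.1 :=
  Primrec.fst.comp (Primrec.snd.comp .snd)
theorem primrec_left : Primrec fun q : ℕ × ℕ × σ × σ × σ => q.2.2.2.1 :=
  Primrec.fst.comp (Primrec.snd.comp (Primrec.snd.comp .snd))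
theorem primrec_right : Primrec fun q : ℕ × ℕ × σ × σ × σ => q.2.2.2.2 :=
  Primrec.snd.comp (Primrec.snd.comp (Primrec.snd.comp .snd))

theorem primrec_termCode : Primrec termCode :=
  Primrec.codeFold _ <|
    .ite_eq primrec_tag (.const 2) (.const true) <|
    .ite_eq primrec_tag (.const 4) (Primrec.or.comp primrec_left primrec_right) <|
    .ite_eq primrec_tag (.const 5) (Primrec.and.comp primrec_left primrec_right) <|
    .ite_eq primrec_tag (.const 6) (.const true) (.const false)

theorem primrec_projCode : Primrec projCode :=
  Primrec.codeFold _ <|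
    .ite_eq primrec_tag (.const 5)
      (.natPair (.const 5) (.natPair primrec_left primrec_payload.unpair_snd)) <|
    .ite_eq primrec_tag (.const 7)
      (.natPair (.const 5) (.natPair primrec_left
        (.natPair (.const 6) primrec_payload.unpair_snd))) <|
    .natPair primrec_tag primrec_payload

theorem primrec_tailDepthCode : Primrec tailDepthCode :=
  Primrec.codeFold _ <|
    .ite_eq primrec_tag (.const 4) (Primrec.nat_max.comp primrec_left primrec_right) <|
    .ite_eq primrec_tag (.const 5) (Primrec.succ.comp primrec_right) (.const 0)

/-- Products and stacked products with a right factor depending on a parameter are applied to all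
targets of a list of transitions by a primitive recursive function. -/
theorem Primrec.map_succ_pair {α : Type*} [Primcodable α] {f : α → List (Option ℕ × ℕ)}
    {g : α → ℕ} (k : ℕ) (hf : Primrec f) (hg : Primrec g) :
    Primrec fun a => (f a).map fun p => (p.1, Nat.pair k (Nat.pair p.2 (g a))) :=
  Primrec.list_map hf (Primrec.pair (Primrec.fst.comp .snd) (.natPair (.const k)
    (.natPair (Primrec.snd.comp .snd) (hg.comp .fst))))

theorem Primrec.map_pair {α : Type*} [Primcodable α] {f : α → List ℕ}
    {g : α → ℕ} (k : ℕ) (hf : Primrec f) (hg : Primrec g) :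
    Primrec fun a => (f a).map fun n => Nat.pair k (Nat.pair n (g a)) :=
  Primrec.list_map hf (Primrec.natPair (.const k) (.natPair .snd (hg.comp .fst)))

theorem Primrec.list_singleton {α β : Type*} [Primcodable α] [Primcodable β] {f : α → β}
    (hf : Primrec f) : Primrec fun a => [f a] :=
  Primrec.list_cons.comp hf (.const [])

theorem primrec_succCode : Primrec succCode := by
  refine Primrec.codeFold _ ?_
  unfold succStep
  exact
    .ite_eq primrec_tag (.const 3)
      (.list_singleton (.pair (Primrec.option_some.comp primrec_payload) (.const _))) <|
    .ite_eq primrec_tag (.const 4) (Primrec.list_append.comp primrec_left primrec_right) <|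
    .ite_eq primrec_tag (.const 5)
      (Primrec.list_append.comp (.map_succ_pair 5 primrec_left primrec_payload.unpair_snd)
        (.ite_bool (primrec_termCode.comp primrec_payload.unpair_fst) primrec_right
          (.const []))) <|
    .ite_eq primrec_tag (.const 6) (.map_succ_pair 7 primrec_value primrec_payload) <|
    .ite_eq primrec_tag (.const 7)
      (Primrec.list_append.comp (.map_succ_pair 7 primrec_left primrec_payload.unpair_snd)
        (.ite_bool (primrec_termCode.comp primrec_payload.unpair_fst)
          (.list_singleton (.pair (.const none)
            (.natPair (.const 6) primrec_payload.unpair_snd))) (.const []))) <|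
    .const []

theorem primrec_derivsCode : Primrec derivsCode := by
  refine Primrec.codeFold _ ?_
  unfold derivsStep
  exact
    .ite_eq primrec_tag (.const 3) (.const _) <|
    .ite_eq primrec_tag (.const 4) (Primrec.list_append.comp primrec_left primrec_right) <|
    .ite_eq primrec_tag (.const 5)
      (Primrec.list_append.comp (.map_pair 5 primrec_left primrec_payload.unpair_snd)
        (.ite_bool (Primrec.or.comp (primrec_termCode.comp primrec_payload.unpair_fst)
          ((Primrec.list_any primrec_termCode).comp primrec_left)) primrec_right
          (.const []))) <|
    .ite_eq primrec_tag (.const 6)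
      (Primrec.list_append.comp (.map_pair 7 primrec_value primrec_payload)
        (.ite_bool ((Primrec.list_any primrec_termCode).comp primrec_value)
          (.list_singleton (.natPair (.const 6) primrec_payload)) (.const []))) <|
    .const []

theorem primrec_transListCode : Primrec transListCode :=
  Primrec.list_flatMap .id <| Primrec.list_map (primrec_succCode.comp .snd) <|
    Primrec.pair (Primrec.snd.comp .fst) .snd

theorem primrec_rspLhsCode : Primrec rspLhsCode := by
  have he : Primrec fun q : ℕ × ℕ × ℕ => q.1 := .fst
  have hg : Primrec fun q : ℕ × ℕ × ℕ => q.2.1 := Primrec.fst.comp .snd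
  have hv : Primrec fun q : ℕ × ℕ × ℕ => q.2.2 := Primrec.snd.comp .snd
  have hl := hv.unpair_snd.unpair_fst
  have hr := hv.unpair_snd.unpair_snd
  exact .ite_eq hv.unpair_fst (.const 5)
    (.ite_eq (primrec_tailDepthCode.comp hr) (primrec_tailDepthCode.comp hg)
      (.ite_eq hl.unpair_fst (.const 6) he <|
        .ite_eq hl.unpair_fst (.const 7)
          (.natPair (.const 5)
            (.natPair (primrec_projCode.comp hl.unpair_snd.unpair_fst) he)) <|
        .const _)
      (.natPair (.const 5) (.natPair (primrec_projCode.comp hl) hr)))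
    (primrec_projCode.comp hv)

theorem primrec_rspProofCode : Primrec rspProofCode := by
  have hv : Primrec fun q : ℕ × ℕ => q.2 :: derivsCode q.2 :=
    Primrec.list_cons.comp .snd (primrec_derivsCode.comp .snd)
  have hterm : Primrec fun l : List ℕ => l.filter termCode :=
    (Primrec.listFilter (Primrec.eq.comp primrec_termCode (.const true))).of_eq fun l => by
      simp
  have hlabel : Primrec₂ fun (q : ℕ × ℕ) (n : ℕ) =>
      (n, rspLhsCode (q.1, q.2.unpair.2.unpair.2, n), projCode n) :=
    Primrec.pair .snd (.pair
      (primrec_rspLhsCode.comp (.pair (Primrec.fst.comp .fst)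
        (.pair (Primrec.snd.comp .fst).unpair_snd.unpair_snd .snd)))
      (primrec_projCode.comp .snd))
  exact .natPair
    (Primrec.encode.comp (.pair hv (.pair .snd
      (.pair (primrec_transListCode.comp hv) (hterm.comp hv)))))
    (Primrec.encode.comp (Primrec.list_map hv hlabel))

theorem primrec_toCMilCode : Primrec toCMilCode := by
  have hn : Primrec fun q : ℕ × List ℕ => q.1 := .fst
  have heqn := hn.unpair_snd.unpair_fst
  have hsub := hn.unpair_snd.unpair_snd
  have hget {f : ℕ × List ℕ → ℕ} (hf : Primrec f) :
      Primrec fun q : ℕ × List ℕ => q.2.getD (f q) 0 :=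
    (Primrec.list_getD 0).comp .snd hf
  exact Primrec.codeRec <|
    .ite_eq hn.unpair_fst (.const 3) (.natPair (.const 3) (.natPair heqn (hget hsub))) <|
    .ite_eq hn.unpair_fst (.const 4) (.natPair (.const 4) (.natPair heqn
      (.natPair (hget hsub.unpair_fst) (hget hsub.unpair_snd)))) <|
    .ite_eq hn.unpair_fst (.const 5) (.natPair (.const 5) (.natPair heqn
      (.natPair hsub.unpair_fst (hget hsub.unpair_snd)))) <|
    .ite_eq hn.unpair_fst (.const 6) (.natPair (.const 6) (.natPair heqn
      (.natPair (hget hsub) (primrec_rspProofCode.comp (Primrec.unpair.comp heqn))))) <|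
    hn

end Primrec

end CodeOperations

/-! ### Correctness of the operations on codes -/

section CodeCorrectness

variable {A : Type u} (c : A → ℕ)

theorem StExp.code_toStack (e : StExp A) : e.toStack.code c = e.code c := by
  induction e <;> simp_all [StExp.toStack, StExp.code, StackExp.code]

theorem StExp.termCode_code (e : StExp A) : termCode (e.code c) = e.termb := by
  unfold termCode
  induction e <;> simp_all [StExp.code, StExp.termb, codeFold_pair]

theorem StackExp.termCode_code (E : StackExp A) : termCode (E.code c) = E.termb := by
  induction E with
  | zero => exact StExp.termCode_code c .zero
  | one => exact StExp.termCode_code c .one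
  | act a => exact StExp.termCode_code c (.act a)
  | add e f => exact StExp.termCode_code c (.add e f)
  | star e => exact StExp.termCode_code c (.star e)
  | mul E f ih =>
    rw [StackExp.termb, ← ih, ← StExp.termCode_code c f]
    simp [termCode, StackExp.code, codeFold_pair]
  | stk E e => simp [termCode, StackExp.code, StackExp.termb, codeFold_pair]

theorem StackExp.projCode_code (E : StackExp A) : projCode (E.code c) = E.proj.code c := by
  unfold projCode
  induction E <;> simp_all [StExp.code, StackExp.code, StackExp.proj, codeFold_pair]

theorem StExp.tailDepthCode_code (e : StExp A) : tailDepthCode (e.code c) = e.tailDepth := by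
  unfold tailDepthCode
  induction e <;> simp_all [StExp.code, StExp.tailDepth, codeFold_pair]

theorem StExp.succCode_code (e : StExp A) :
    succCode (e.code c) = e.succ.map fun p => (p.1.map c, p.2.code c) := by
  induction e with
  | mul e f ihe ihf =>
    rw [StExp.succ, StExp.code, succCode_pair (by norm_num)]
    simp only [succStep, Nat.unpair_pair, ihe, ihf, StExp.termCode_code]
    cases e.termb <;> simp [StackExp.code]
  | star e ih =>
    rw [StExp.succ, StExp.code, succCode_pair (by norm_num)]
    simp only [succStep, ih]
    simp [StackExp.code]
  | _ => simp_all [succCode_pair, succStep, StExp.code, StExp.succ, StackExp.code]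

theorem StackExp.succCode_code (E : StackExp A) :
    succCode (E.code c) = E.succ.map fun p => (p.1.map c, p.2.code c) := by
  induction E with
  | zero => exact StExp.succCode_code c .zero
  | one => exact StExp.succCode_code c .one
  | act a => exact StExp.succCode_code c (.act a)
  | add e f => exact StExp.succCode_code c (.add e f)
  | star e => exact StExp.succCode_code c (.star e)
  | mul E f ih =>
    rw [StackExp.succ, StackExp.code, succCode_pair (by norm_num)]
    simp only [succStep, Nat.unpair_pair, ih, StExp.succCode_code, StackExp.termCode_code]
    cases E.termb <;> simp [StackExp.code]
  | stk E e ih =>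
    rw [StackExp.succ, StackExp.code, succCode_pair (by norm_num)]
    simp only [succStep, Nat.unpair_pair, ih, StackExp.termCode_code]
    cases E.termb <;> simp [StackExp.code]

theorem any_termCode_map_code (l : List (StackExp A)) :
    (l.map (StackExp.code c)).any termCode = l.any StackExp.termb := by
  rw [List.any_map]
  congr 1
  exact funext (StackExp.termCode_code c)

theorem StExp.derivsCode_code (e : StExp A) :
    derivsCode (e.code c) = e.derivs.map (StackExp.code c) := by
  induction e with
  | mul e f ihe ihf =>
    rw [StExp.derivs, StExp.code, derivsCode_pair (by norm_num)]
    simp only [derivsStep, Nat.unpair_pair, ihe, ihf, StExp.termCode_code,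
      any_termCode_map_code]
    cases e.termb || e.derivs.any StackExp.termb <;> simp [StackExp.code]
  | star e ih =>
    rw [StExp.derivs, StExp.code, derivsCode_pair (by norm_num)]
    simp only [derivsStep, ih, any_termCode_map_code]
    cases e.derivs.any StackExp.termb <;> simp [StackExp.code]
  | _ => simp_all [derivsCode_pair, derivsStep, StExp.code, StExp.derivs, StackExp.code]

theorem transListCode_map_code (l : List (StackExp A)) :
    transListCode (l.map (StackExp.code c)) =
      (transList l).map fun τ => (τ.1.code c, τ.2.1.map c, τ.2.2.code c) := by
  simp only [transListCode, transList, List.flatMap_map, List.map_flatMap,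
    StackExp.succCode_code, List.map_map]
  rfl

theorem rspLhsCode_code (e g : StExp A) (E : StackExp A) :
    rspLhsCode (e.code c, g.code c, E.code c) = (rspLhs e g E).code c := by
  unfold rspLhsCode
  cases E with
  | mul E h =>
    simp only [StackExp.code, Nat.unpair_pair, if_true, StExp.tailDepthCode_code, rspLhs]
    by_cases hd : h.tailDepth = g.tailDepth
    · rw [if_pos hd, if_pos hd]
      cases E <;> simp [StackExp.code, StExp.code, StackExp.projCode_code]
    · rw [if_neg hd, if_neg hd, StackExp.projCode_code, StExp.code]
  | _ => exact (if_neg (by simp [StackExp.code])).trans (StackExp.projCode_code c _)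

theorem rspProofCode_code {e f g : StExp A} (hf : ¬ f.Term) :
    rspProofCode (e.code c, (StExp.mul (StExp.star f) g).code c) =
      (rspCoindProof (e := e) (g := g) hf).code c (StackExp.code c) := by
  have hverts : (StExp.mul (StExp.star f) g).code c ::
      derivsCode ((StExp.mul (StExp.star f) g).code c) =
      (StExp.mul (StExp.star f) g).chart.verts.map (StackExp.code c) := by
    rw [StExp.derivsCode_code, ← StExp.code_toStack, ← List.map_cons]
    rfl
  have hg : ((StExp.mul (StExp.star f) g).code c).unpair.2.unpair.2 = g.code c := by
    simp [StExp.code]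
  unfold rspProofCode LLEECoindProof.code OneChart.code
  simp only [hverts, hg, transListCode_map_code, List.filter_map, List.map_map]
  congr 3
  · exact (congrArg₂ Prod.mk (StExp.code_toStack c _).symm (congrArg₂ Prod.mk rfl
      (congrArg (List.map _) (List.filter_congr fun E _ => StackExp.termCode_code c E))))
  · refine funext fun E => ?_
    simp only [Function.comp, rspLhsCode_code, StackExp.projCode_code]
    rfl

theorem MilDeriv.toCMilCode_code {e f : StExp A} (D : MilDeriv e f) :
    toCMilCode (D.code c) = D.toCMil.code c (StackExp.code c) := by
  induction D with
  | rsp hf D ih =>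
    rw [MilDeriv.toCMil, CMilOneDeriv.code, ← ih, ← rspProofCode_code, MilDeriv.code,
      toCMilCode_pair (by norm_num)]
    simp [eqnCode]
  | _ => simp_all [MilDeriv.code, MilDeriv.toCMil, CMilOneDeriv.code, toCMilCode_pair]

end CodeCorrectness

theorem mainTheorem2 {A : Type u} :
    (∀ e f : StExp A, Nonempty (MilDeriv e f) → Nonempty (CMilOneDeriv (StackExp A) e f)) ∧
    ∃ T : (e f : StExp A) → MilDeriv e f → CMilOneDeriv (StackExp A) e f,
      (∀ (e f : StExp A) (D : MilDeriv e f), Mimics D (T e f D)) ∧ Effective T := by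
  refine ⟨fun _ _ ⟨D⟩ => ⟨D.toCMil⟩, fun _ _ D => D.toCMil, fun _ _ D => D.mimics_toCMil, ?_⟩
  exact ⟨toCMilCode, primrec_toCMilCode.to_comp, fun _ _ D c _ => D.toCMilCode_code c⟩
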